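/- Work in affine continuous logic. A Lipschitz language \(L\) (of arbitrary cardinality) consists of constant symbols and of function and relation symbols of arity \(\ge 1\), each with a Lipschitz constant \(\lambda\ge 0\). An \(L\)-prestructure is a nonempty pseudometric space of diameter at most \(1\) with interpretations of the constants, \(\lambda_F\)-Lipschitz operations \(F^M:M^n\to M\) and \(\lambda_R\)-Lipschitz relations \(R^M:M^n\to[0,1]\) (where \(M^n\) has the sum metric); it is an \(L\)-structure if the pseudometric is a complete metric. Formulas are built from \(1\), \(d(t_1,t_2)\), \(R(t_1,\dots,t_n)\) by addition, multiplication by real scalars, \(\inf_x\) and \(\sup_x\), and \(\phi^M\) is defined in the usual way. For \(A\subseteq M\), let \(\mathbb D_1(A)\) be the ordered vector space of the functions \(\phi^M:M\to\mathbb R\), where \(\phi(x)\) is a formula with parameters from \(A\). A type in \(K_1(A)\) is a positive linear functional \(p:\mathbb D_1(A)\to\mathbb R\) with \(p(1)=1\); it is realized by \(a\in M\) if \(p(\phi)=\phi^M(a)\) for all \(\phi\). \(M\) is \(\lambda\)-saturated if for every \(A\subseteq M\) with \(|A|<\lambda\) every \(p\in K_1(A)\) is realized in \(M\). A charge space \((I,\mathcal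 A,\mu)\) is a set \(I\) with a Boolean algebra \(\mathcal A\) of subsets of \(I\) and a finitely additive probability measure \(\mu\) on \(\mathcal A\). An \(L\)-structure \(M\) is \(\mathcal A\)-meanable if \(M\) is finite or \(\mathcal A\) is closed under intersections of at most \(w(M)\) members, where \(w(M)\) is \(\aleph_0\) plus the least cardinality of a basis of the topology of \(M\). In this case the powermean \(M^\mu\) is the \(L\)-prestructure of all maps \(a:I\to M\) such that \(a^{-1}(B)\in\mathcal A\) for every Borel \(B\subseteq M\), modulo \(\int d(a_i,b_i)\,d\mu=0\), with \(d([a],[b])=\int d(a_i,b_i)\,d\mu\), \(c^{M^\mu}=[c^M]\), \(F^{M^\mu}([a^1],\dots,[a^n])=[F^M(a^1_i,\dots,a^n_i)]\) and \(R^{M^\mu}([a^1],\dots,[a^n])=\int R^M(a^1_i,\dots,a^n_i)\,d\mu\) (no completion is taken). **Theorem.** Let \(M\) be an \(L\)-structure and \(\kappa\) an infinite cardinal such that \(M\) has a dense subset of cardinality at most \(\kappa\). Then there is a charge space \((I,\mathcal A,\wp)\) such that \(M\) is \(\mathcal A\)-meanable and the powermean \(M^\wp\) is \(\kappa^+\)-saturated.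 -/

import Mathlib

open Set Topology MeasureTheory Cardinal

open scoped NNReal

universe u v w z

/-! ### Syntax of affine continuous logic -/

/-- A Lipschitz language: constant symbols, and function and relation symbols of arities `≥ 1`, each
with a Lipschitz constant. The metric symbol is treated as a logical symbol. -/
structure LipschitzLanguage where
  Const : Type u
  Func : Type v
  Rel : Type w
  funcArity : Func → ℕ
  relArity : Rel → ℕ
  funcArity_pos : ∀ F, 0 < funcArity F
  relArity_pos : ∀ R, 0 < relArity R
  funcLip : Func → ℝ≥0
  relLip : Rel → ℝ≥0

namespace LipschitzLanguage

/-- The language `L(A)`, with a new constant symbol for every element of `A`. -/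
def withConstants (L : LipschitzLanguage.{u, v, w}) (A : Type z) :
    LipschitzLanguage.{max u z, v, w} where
  Const := L.Const ⊕ A
  Func := L.Func
  Rel := L.Rel
  funcArity := L.funcArity
  relArity := L.relArity
  funcArity_pos := L.funcArity_pos
  relArity_pos := L.relArity_pos
  funcLip := L.funcLip
  relLip := L.relLip

/-- Terms with variables `x_0, …, x_{n-1}`. -/
inductive Term (L : LipschitzLanguage.{u, v, w}) (n : ℕ) : Type (max u v)
  | var (i : Fin n) : Term L n
  | const (c : L.Const) : Term L n
  | app (F : L.Func) (ts : Fin (L.funcArity F) → Term L n) : Term L n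

/-- Affine formulas with free variables among `x_0, …, x_{n-1}`; the quantifiers
`inf` and `sup` bind the last variable. -/
inductive Formula (L : LipschitzLanguage.{u, v, w}) : ℕ → Type (max u v w)
  | one {n : ℕ} : Formula L n
  | metric {n : ℕ} (t₁ t₂ : Term L n) : Formula L n
  | rel {n : ℕ} (R : L.Rel) (ts : Fin (L.relArity R) → Term L n) : Formula L n
  | add {n : ℕ} (φ ψ : Formula L n) : Formula L n
  | smul {n : ℕ} (r : ℝ) (φ : Formula L n) : Formula L n
  | inf {n : ℕ} (φ : Formula L (n + 1)) : Formula L n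
  | sup {n : ℕ} (φ : Formula L (n + 1)) : Formula L n

end LipschitzLanguage

/-! ### Structures -/

/-- The diameter is at most `1`. -/
class DiamLEOne (M : Type z) [PseudoMetricSpace M] : Prop where
  dist_le_one : ∀ x y : M, dist x y ≤ 1

/-- A prestructure in the language `L` on a pseudometric space of diameter at most `1`; it is a
structure when the pseudometric is a complete metric. The power `M^n` carries the sum metric. -/
class Prestructure (L : LipschitzLanguage.{u, v, w}) (M : Type z) [PseudoMetricSpace M]
    [DiamLEOne M] where
  const : L.Const → M
  func : (F : L.Func) → (Fin (L.funcArity F) → M) → M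
  rel : (R : L.Rel) → (Fin (L.relArity R) → M) → ℝ
  func_lip : ∀ (F : L.Func) (a b : Fin (L.funcArity F) → M),
    dist (func F a) (func F b) ≤ L.funcLip F * ∑ k, dist (a k) (b k)
  rel_mem : ∀ (R : L.Rel) (a : Fin (L.relArity R) → M), rel R a ∈ Set.Icc (0 : ℝ) 1
  rel_lip : ∀ (R : L.Rel) (a b : Fin (L.relArity R) → M),
    rel R a - rel R b ≤ L.relLip R * ∑ k, dist (a k) (b k)

namespace LipschitzLanguage

section Semantics

variable {L : LipschitzLanguage.{u, v, w}} {M : Type z} [PseudoMetricSpace M] [DiamLEOne M]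
  [Prestructure L M]

/-- The value `t^M(a)` of a term. -/
def Term.realize {n : ℕ} : Term L n → (Fin n → M) → M
  | .var i, a => a i
  | .const c, _ => Prestructure.const c
  | .app F ts, a => Prestructure.func F fun k => (ts k).realize a

/-- The value `φ^M(a)` of a formula. -/
noncomputable def Formula.realize : {n : ℕ} → Formula L n → (Fin n → M) → ℝ
  | _, .one, _ => 1
  | _, .metric t₁ t₂, a => dist (t₁.realize a) (t₂.realize a)
  | _, .rel R ts, a => Prestructure.rel R fun k => (ts k).realize a
  | _, .add φ ψ, a => φ.realize a + ψ.realize a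
  | _, .smul r φ, a => r * φ.realize a
  | _, .inf φ, a => ⨅ b : M, φ.realize (Fin.snoc a b)
  | _, .sup φ, a => ⨆ b : M, φ.realize (Fin.snoc a b)

end Semantics

end LipschitzLanguage

open LipschitzLanguage

/-- The expansion `(M, a)_{a ∈ A}` of `M` to the language `L(A)`. -/
instance Prestructure.withConstants (L : LipschitzLanguage.{u, v, w}) (M : Type z)
    [PseudoMetricSpace M] [DiamLEOne M] [Prestructure L M] (A : Set M) :
    Prestructure (L.withConstants A) M where
  const := Sum.elim (Prestructure.const (L := L)) Subtype.val
  func := Prestructure.func (L := L)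
  rel := Prestructure.rel (L := L)
  func_lip := Prestructure.func_lip (L := L)
  rel_mem := Prestructure.rel_mem (L := L)
  rel_lip := Prestructure.rel_lip (L := L)

/-! ### Types and saturation -/

section Types

variable (L : LipschitzLanguage.{u, v, w}) (M : Type z) [PseudoMetricSpace M] [DiamLEOne M]
  [Prestructure L M]

/-- The space `𝔻_n(A)` of formulas in `n` free variables with parameters from `A`, two formulas
being identified when they define the same function on `M^n`. -/
def formulaSpace (A : Set M) (n : ℕ) : Submodule ℝ ((Fin n → M) → ℝ) where
  carrier := Set.range fun (φ : Formula (L.withConstants A) n) (a : Fin n → M) => φ.realize a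
  add_mem' := by
    rintro _ _ ⟨φ, rfl⟩ ⟨ψ, rfl⟩
    exact ⟨.add φ ψ, rfl⟩
  zero_mem' := ⟨.smul 0 .one, by funext a; simp [Formula.realize]⟩
  smul_mem' := by
    rintro r _ ⟨φ, rfl⟩
    exact ⟨.smul r φ, rfl⟩

variable {L M} in
/-- The element of `𝔻_n(A)` given by a formula. -/
noncomputable def LipschitzLanguage.Formula.toSpace {A : Set M} {n : ℕ} (φ : Formula (L.withConstants A) n) :
    formulaSpace L M A n :=
  ⟨fun a => φ.realize a, φ, rfl⟩

/-- `K_n(A)`: an `n`-type over `A` is a positive linear functional `p` on `𝔻_n(A)` with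
`p(1) = 1`. -/
structure AffineType (A : Set M) (n : ℕ) where
  toLinearMap : formulaSpace L M A n →ₗ[ℝ] ℝ
  nonneg : ∀ f : formulaSpace L M A n, (∀ a, 0 ≤ f.1 a) → 0 ≤ toLinearMap f
  map_one : toLinearMap (Formula.one (L := L.withConstants A)).toSpace = 1

variable {L M} in
/-- `p` is realized by the tuple `a`: `p(φ) = φ^M(a)` for every formula `φ` over `A`. -/
def AffineType.RealizedBy {A : Set M} {n : ℕ} (p : AffineType L M A n) (a : Fin n → M) : Prop :=
  ∀ φ : Formula (L.withConstants A) n, p.toLinearMap φ.toSpace = φ.realize a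

/-- `M` is `κ`-saturated: for every `A ⊆ M` with `|A| < κ`, every type in `K_1(A)` is
realized in `M`. -/
def IsSaturated (κ : Cardinal.{z}) : Prop :=
  ∀ A : Set M, #A < κ → ∀ p : AffineType L M A 1, ∃ a : Fin 1 → M, p.RealizedBy a

end Types

/-! ### Cardinal invariants of metric spaces -/

/-- The density character: the least cardinality of a dense subset. -/
noncomputable def densityCharacter (M : Type z) [TopologicalSpace M] : Cardinal.{z} :=
  sInf {c | ∃ X : Set M, Dense X ∧ #X = c}

/-- The topological weight: the least cardinality of a basis, plus `ℵ₀`. -/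
noncomputable def topologicalWeight (M : Type z) [TopologicalSpace M] : Cardinal.{z} :=
  sInf {c | ∃ O : Set (Set M), TopologicalSpace.IsTopologicalBasis O ∧ #O = c} + ℵ₀

/-! ### Charge spaces and integration -/

/-- A (probability) charge space structure on `I`: a Boolean algebra of subsets of `I` and a
finitely additive probability measure on it. -/
structure ChargeSpace (I : Type z) where
  algebra : Set (Set I)
  isSetAlgebra : IsSetAlgebra algebra
  charge : AddContent ℝ≥0 algebra
  charge_univ : charge Set.univ = 1

namespace ChargeSpace

section Integral

variable {I : Type z} (μ : ChargeSpace I)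

/-- The step function `∑ c • 1_E` given by a list of pairs `(c, E)`. -/
noncomputable def stepFun (l : List (ℝ × Set I)) (i : I) : ℝ :=
  (l.map fun p => p.2.indicator (fun _ => p.1) i).sum

/-- The integral `∑ c * μ(E)` of the step function given by a list of pairs `(c, E)`. -/
noncomputable def stepIntegral (l : List (ℝ × Set I)) : ℝ :=
  (l.map fun p => p.1 * (μ.charge p.2 : ℝ)).sum

/-- The integrals `∫ s dμ` of the `𝒜`-measurable step functions `s ≥ f`. -/
def upperSums (f : I → ℝ) : Set ℝ :=
  {x | ∃ l : List (ℝ × Set I), (∀ p ∈ l, p.2 ∈ μ.algebra) ∧ (∀ i, f i ≤ stepFun l i) ∧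
    x = μ.stepIntegral l}

/-- The integral `∫ f dμ` of a bounded function, as the infimum of the integrals of the measurable
step functions above `f`. For bounded `𝒜`-measurable `f` it agrees with the supremum of the
integrals of the measurable step functions below `f`: see `ChargeSpace.integral_neg`. -/
noncomputable def integral (f : I → ℝ) : ℝ :=
  sInf (μ.upperSums f)

theorem stepFun_append (l l' : List (ℝ × Set I)) (i : I) :
    stepFun (l ++ l') i = stepFun l i + stepFun l' i := by
  simp [stepFun]

theorem stepIntegral_append (l l' : List (ℝ × Set I)) :
    μ.stepIntegral (l ++ l') = μ.stepIntegral l + μ.stepIntegral l' := by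
  simp [stepIntegral]

/-- Scalar multiples of step functions. -/
def scaleStep (r : ℝ) (l : List (ℝ × Set I)) : List (ℝ × Set I) :=
  l.map fun p => (r * p.1, p.2)

theorem stepFun_scale (r : ℝ) (l : List (ℝ × Set I)) (i : I) :
    stepFun (scaleStep r l) i = r * stepFun l i := by
  induction l with
  | nil => simp [stepFun, scaleStep]
  | cons p l ih =>
    simp only [stepFun, scaleStep, List.map_cons, List.sum_cons] at ih ⊢
    rw [ih, mul_add]
    congr 1
    by_cases h : i ∈ p.2 <;> simp [h]

theorem stepIntegral_scale (r : ℝ) (l : List (ℝ × Set I)) :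
    μ.stepIntegral (scaleStep r l) = r * μ.stepIntegral l := by
  induction l with
  | nil => simp [stepIntegral, scaleStep]
  | cons p l ih =>
    simp only [stepIntegral, scaleStep, List.map_cons, List.sum_cons] at ih ⊢
    rw [ih]
    ring

theorem scale_mem {l : List (ℝ × Set I)} (hl : ∀ p ∈ l, p.2 ∈ μ.algebra) (r : ℝ) :
    ∀ p ∈ scaleStep r l, p.2 ∈ μ.algebra := by
  intro p hp
  obtain ⟨q, hq, rfl⟩ := List.mem_map.1 hp
  exact hl q hq

theorem charge_split {X E : Set I} (hX : X ∈ μ.algebra) (hE : E ∈ μ.algebra) :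
    (μ.charge X : ℝ) = μ.charge (X ∩ E) + μ.charge (X \ E) := by
  have h := addContent_union (m := μ.charge) μ.isSetAlgebra.isSetRing
    (μ.isSetAlgebra.inter_mem hX hE) (μ.isSetAlgebra.sdiff_mem hX hE)
    (Set.disjoint_sdiff_inter.symm)
  rw [Set.inter_union_sdiff] at h
  exact_mod_cast congrArg NNReal.toReal h

theorem stepIntegral_nonneg_aux (l : List (ℝ × Set I)) (hl : ∀ p ∈ l, p.2 ∈ μ.algebra) :
    ∀ X ∈ μ.algebra, ∀ c : ℝ, (∀ i ∈ X, 0 ≤ c + stepFun l i) →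
      0 ≤ c * μ.charge X + (l.map fun p => p.1 * (μ.charge (X ∩ p.2) : ℝ)).sum := by
  induction l with
  | nil =>
    intro X hX c h
    rcases X.eq_empty_or_nonempty with rfl | ⟨i, hi⟩
    · simp
    · have := h i hi
      simp only [stepFun, List.map_nil, List.sum_nil, add_zero] at this ⊢
      positivity
  | cons p l ih =>
    intro X hX c h
    have hp : p.2 ∈ μ.algebra := hl p (by simp)
    have hl' : ∀ q ∈ l, q.2 ∈ μ.algebra := fun q hq => hl q (by simp [hq])
    have h1 := ih hl' (X ∩ p.2) (μ.isSetAlgebra.inter_mem hX hp) (c + p.1) (by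
      intro i hi
      have := h i hi.1
      simp only [stepFun, List.map_cons, List.sum_cons, Set.indicator_of_mem hi.2] at this ⊢
      linarith)
    have h2 := ih hl' (X \ p.2) (μ.isSetAlgebra.sdiff_mem hX hp) c (by
      intro i hi
      have := h i hi.1
      simp only [stepFun, List.map_cons, List.sum_cons, Set.indicator_of_notMem hi.2] at this ⊢
      linarith)
    have h3 : (l.map fun q => q.1 * (μ.charge (X ∩ q.2) : ℝ)).sum =
        (l.map fun q => q.1 * (μ.charge (X ∩ p.2 ∩ q.2) : ℝ)).sum +
          (l.map fun q => q.1 * (μ.charge (X \ p.2 ∩ q.2) : ℝ)).sum := by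
      rw [← List.sum_map_add]
      congr 1
      refine List.map_congr_left fun q hq => ?_
      rw [μ.charge_split (μ.isSetAlgebra.inter_mem hX (hl' q hq)) hp, ← mul_add,
        Set.inter_right_comm, Set.inter_sdiff_right_comm]
    rw [List.map_cons, List.sum_cons, h3, μ.charge_split hX hp]
    linarith

/-- The integral of a nonnegative step function is nonnegative. -/
theorem stepIntegral_nonneg {l : List (ℝ × Set I)} (hl : ∀ p ∈ l, p.2 ∈ μ.algebra)
    (h : ∀ i, 0 ≤ stepFun l i) : 0 ≤ μ.stepIntegral l := by
  have := μ.stepIntegral_nonneg_aux l hl Set.univ μ.isSetAlgebra.univ_mem 0 (by simpa using h)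
  simpa [stepIntegral] using this

/-- The constant step function. -/
theorem stepFun_const (c : ℝ) (i : I) : stepFun [(c, Set.univ)] i = c := by
  simp [stepFun]

theorem stepIntegral_const (c : ℝ) : μ.stepIntegral [(c, Set.univ)] = c := by
  simp [stepIntegral, μ.charge_univ]

theorem le_of_mem_upperSums {f : I → ℝ} {C x : ℝ} (hf : ∀ i, C ≤ f i) (hx : x ∈ μ.upperSums f) :
    C ≤ x := by
  obtain ⟨l, hl, hle, rfl⟩ := hx
  have h := μ.stepIntegral_nonneg (l := l ++ [(-C, Set.univ)])
    (by
      intro p hp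
      rcases List.mem_append.1 hp with hp | hp
      · exact hl p hp
      · rw [List.mem_singleton.1 hp]
        exact μ.isSetAlgebra.univ_mem)
    (by
      intro i
      rw [stepFun_append, stepFun_const]
      linarith [hf i, hle i])
  rw [stepIntegral_append, stepIntegral_const] at h
  linarith

theorem const_mem_upperSums {f : I → ℝ} {C : ℝ} (hf : ∀ i, f i ≤ C) : C ∈ μ.upperSums f := by
  refine ⟨[(C, Set.univ)], ?_, fun i => ?_, (μ.stepIntegral_const C).symm⟩
  · intro p hp
    rw [List.mem_singleton.1 hp]
    exact μ.isSetAlgebra.univ_mem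
  · rw [stepFun_const]
    exact hf i

theorem integral_le {f : I → ℝ} {C x : ℝ} (hf : ∀ i, C ≤ f i) (hx : x ∈ μ.upperSums f) :
    μ.integral f ≤ x :=
  csInf_le ⟨C, fun _ hy => μ.le_of_mem_upperSums hf hy⟩ hx

theorem integral_le_const {f : I → ℝ} {c C : ℝ} (hf : ∀ i, c ≤ f i) (hf' : ∀ i, f i ≤ C) :
    μ.integral f ≤ C :=
  μ.integral_le hf (μ.const_mem_upperSums hf')

theorem const_le_integral {f : I → ℝ} {c C : ℝ} (hf : ∀ i, c ≤ f i) (hf' : ∀ i, f i ≤ C) :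
    c ≤ μ.integral f :=
  le_csInf ⟨C, μ.const_mem_upperSums hf'⟩ fun _ hy => μ.le_of_mem_upperSums hf hy

theorem integral_const (c : ℝ) : μ.integral (fun _ : I => c) = c :=
  le_antisymm (μ.integral_le_const (fun _ => le_rfl) fun _ => le_rfl)
    (μ.const_le_integral (fun _ => le_rfl) fun _ => le_rfl)

/-- Monotonicity of the integral. -/
theorem integral_mono {f g : I → ℝ} {c C : ℝ} (hf : ∀ i, c ≤ f i) (hg : ∀ i, g i ≤ C)
    (h : ∀ i, f i ≤ g i) : μ.integral f ≤ μ.integral g := by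
  refine le_csInf ⟨C, μ.const_mem_upperSums hg⟩ ?_
  rintro _ ⟨l, hl, hle, rfl⟩
  exact μ.integral_le hf ⟨l, hl, fun i => (h i).trans (hle i), rfl⟩

/-- Subadditivity of the integral. -/
theorem integral_add_le {f g : I → ℝ} {c C : ℝ} (hf : ∀ i, c ≤ f i) (hf' : ∀ i, f i ≤ C)
    (hg : ∀ i, c ≤ g i) (hg' : ∀ i, g i ≤ C) :
    μ.integral (fun i => f i + g i) ≤ μ.integral f + μ.integral g := by
  rw [← sub_le_iff_le_add]
  refine le_csInf ⟨C, μ.const_mem_upperSums hf'⟩ ?_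
  rintro _ ⟨l, hl, hle, rfl⟩
  rw [sub_le_comm]
  refine le_csInf ⟨C, μ.const_mem_upperSums hg'⟩ ?_
  rintro _ ⟨l', hl', hle', rfl⟩
  rw [sub_le_iff_le_add', ← stepIntegral_append]
  refine μ.integral_le (C := c + c) (fun i => add_le_add (hf i) (hg i)) ⟨l ++ l', ?_, ?_, rfl⟩
  · intro p hp
    exact (List.mem_append.1 hp).elim (hl p) (hl' p)
  · intro i
    rw [stepFun_append]
    exact add_le_add (hle i) (hle' i)

/-- Homogeneity of the integral. -/
theorem integral_smul_le {f : I → ℝ} {c C r : ℝ} (hr : 0 ≤ r) (hf : ∀ i, c ≤ f i)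
    (hf' : ∀ i, f i ≤ C) : μ.integral (fun i => r * f i) ≤ r * μ.integral f := by
  rcases hr.eq_or_lt with rfl | hr'
  · simpa using (μ.integral_const 0).le
  · rw [← div_le_iff₀' hr']
    refine le_csInf ⟨C, μ.const_mem_upperSums hf'⟩ ?_
    rintro _ ⟨l, hl, hle, rfl⟩
    rw [div_le_iff₀' hr', ← stepIntegral_scale]
    refine μ.integral_le (C := r * c) (fun i => mul_le_mul_of_nonneg_left (hf i) hr)
      ⟨scaleStep r l, μ.scale_mem hl r, fun i => ?_, rfl⟩
    rw [stepFun_scale]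
    exact mul_le_mul_of_nonneg_left (hle i) hr

theorem integral_sum_le {n : ℕ} (f : Fin n → I → ℝ) (hf : ∀ k i, 0 ≤ f k i)
    (hf' : ∀ k i, f k i ≤ 1) :
    μ.integral (fun i => ∑ k, f k i) ≤ ∑ k, μ.integral (f k) := by
  induction n with
  | zero => simpa using (μ.integral_const 0).le
  | succ n ih =>
    simp only [Fin.sum_univ_succ]
    have hsum : ∀ i, ∑ k : Fin n, f k.succ i ≤ n := fun i =>
      (Finset.sum_le_sum fun k _ => hf' k.succ i).trans (by simp)
    refine (μ.integral_add_le (c := 0) (C := n + 1) (hf 0) ?_ ?_ ?_).trans ?_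
    · exact fun i => (hf' 0 i).trans (by simp)
    · exact fun i => Finset.sum_nonneg fun k _ => hf k.succ i
    · exact fun i => (hsum i).trans (by simp)
    · exact add_le_add le_rfl (ih (fun k => f k.succ) (fun k => hf _) fun k => hf' _)

/-- For a bounded measurable function the upper and the lower integral coincide. -/
theorem integral_neg {f : I → ℝ} {C : ℝ} (hf : ∀ r s : ℝ, f ⁻¹' Set.Ico r s ∈ μ.algebra)
    (hC : ∀ i, |f i| ≤ C) : μ.integral (fun i => -f i) = -μ.integral f := by
  have hlo : ∀ i, -C ≤ f i := fun i => (abs_le.1 (hC i)).1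
  have hhi : ∀ i, f i ≤ C := fun i => (abs_le.1 (hC i)).2
  apply le_antisymm
  · refine le_of_forall_pos_le_add fun ε hε => ?_
    obtain ⟨N, hN⟩ := exists_nat_gt ((C + C) / ε)
    rw [div_lt_iff₀ hε] at hN
    set l : List (ℝ × Set I) := (List.range N).map fun k : ℕ =>
      (-C + (k + 1) * ε, f ⁻¹' Set.Ico (-C + k * ε) (-C + (k + 1) * ε)) with hldef
    have hl : ∀ p ∈ l, p.2 ∈ μ.algebra := by
      intro p hp
      obtain ⟨k, -, rfl⟩ := List.mem_map.1 hp
      exact hf _ _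
    have hstep : ∀ i, f i ≤ stepFun l i ∧ stepFun l i ≤ f i + ε := by
      intro i
      have h0 : 0 ≤ (f i + C) / ε := div_nonneg (by linarith [hlo i]) hε.le
      set k := ⌊(f i + C) / ε⌋₊ with hk
      have h1 : (k : ℝ) * ε ≤ f i + C := (le_div_iff₀ hε).1 (Nat.floor_le h0)
      have h2 : f i + C < (k + 1) * ε := (div_lt_iff₀ hε).1 (Nat.lt_floor_add_one _)
      have hkN : k < N := by
        rw [hk, Nat.floor_lt h0, div_lt_iff₀ hε]
        linarith [hhi i]
      have heval : stepFun l i = -C + (k + 1) * ε := by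
        have : stepFun l i = ∑ j ∈ Finset.range N,
            (f ⁻¹' Set.Ico (-C + j * ε) (-C + (j + 1) * ε)).indicator
              (fun _ => -C + ((j : ℝ) + 1) * ε) i := by
          simp [stepFun, hldef, Finset.sum, Finset.range, Multiset.range, Function.comp_def]
        rw [this, Finset.sum_eq_single k]
        · rw [Set.indicator_of_mem]
          constructor <;> linarith
        · intro j _ hjk
          rw [Set.indicator_of_notMem]
          rintro ⟨h3, h4⟩
          apply hjk
          have h5 : (j : ℝ) * ε < (k + 1) * ε := by linarith
          have h6 : (k : ℝ) * ε < (j + 1) * ε := by linarith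
          have h7 : (j : ℝ) < k + 1 := lt_of_mul_lt_mul_right h5 hε.le
          have h8 : (k : ℝ) < j + 1 := lt_of_mul_lt_mul_right h6 hε.le
          have h9 : j < k + 1 := by exact_mod_cast h7
          have h10 : k < j + 1 := by exact_mod_cast h8
          omega
        · intro h
          exact absurd (Finset.mem_range.2 hkN) h
      rw [heval]
      constructor <;> linarith
    have h1 : μ.integral f ≤ μ.stepIntegral l :=
      μ.integral_le hlo ⟨l, hl, fun i => (hstep i).1, rfl⟩
    have h2 : μ.integral (fun i => -f i) ≤
        μ.stepIntegral (scaleStep (-1) l ++ [(ε, Set.univ)]) := by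
      refine μ.integral_le (C := -C) (fun i => neg_le_neg (hhi i)) ⟨_, ?_, ?_, rfl⟩
      · intro p hp
        rcases List.mem_append.1 hp with hp | hp
        · exact μ.scale_mem hl _ p hp
        · rw [List.mem_singleton.1 hp]
          exact μ.isSetAlgebra.univ_mem
      · intro i
        rw [stepFun_append, stepFun_scale, stepFun_const]
        linarith [(hstep i).2]
    rw [stepIntegral_append, stepIntegral_scale, stepIntegral_const] at h2
    linarith
  · have h := μ.integral_add_le (f := f) (g := fun i => -f i) (c := -C) (C := C) hlo hhi
      (fun i => neg_le_neg (hhi i)) (fun i => by linarith [hlo i])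
    simp only [add_neg_cancel, μ.integral_const] at h
    linarith

end Integral

/-! ### Meanability -/

/-- A family of sets is `κ`-complete: closed under intersections of fewer than `κ` members. -/
def IsComplete {I : Type z} (𝒜 : Set (Set I)) (κ : Cardinal.{z}) : Prop :=
  ∀ S : Set (Set I), S ⊆ 𝒜 → #S < κ → ⋂₀ S ∈ 𝒜

/-- `M` is `𝒜`-meanable: `M` is finite or `𝒜` is `w(M)⁺`-complete. -/
class IsMeanable {I : Type z} (μ : ChargeSpace I) (M : Type z) [TopologicalSpace M] : Prop where
  finite_or_complete : Finite M ∨ IsComplete μ.algebra (Order.succ (topologicalWeight M))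

/-- `a : I → M` is `𝒜`-measurable: preimages of Borel sets belong to `𝒜`. -/
def IsMeasurableMap {I : Type z} (μ : ChargeSpace I) {M : Type z} [TopologicalSpace M]
    (a : I → M) : Prop :=
  ∀ B : Set M, MeasurableSet[borel M] B → a ⁻¹' B ∈ μ.algebra

theorem IsMeasurableMap.const {I : Type z} (μ : ChargeSpace I) {M : Type z} [TopologicalSpace M]
    (m : M) : μ.IsMeasurableMap fun _ => m := by
  intro B _
  by_cases h : m ∈ B
  · simpa [Set.preimage_const, h] using μ.isSetAlgebra.univ_mem
  · simpa [Set.preimage_const, h] using μ.isSetAlgebra.empty_mem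

/-- If `M` is `𝒜`-meanable, continuous operations preserve measurability. -/
theorem IsMeasurableMap.comp {I : Type z} (μ : ChargeSpace I) {M : Type z} [MetricSpace M]
    [hM : μ.IsMeanable M] {n : ℕ} (g : (Fin n → M) → M) (hg : Continuous g) (a : Fin n → I → M)
    (ha : ∀ k, μ.IsMeasurableMap (a k)) : μ.IsMeasurableMap fun i => g fun k => a k i := by
  classical
  intro B hB
  rcases hM.finite_or_complete with hfin | hcomp
  · have := Fintype.ofFinite M
    have : (fun i => g fun k => a k i) ⁻¹' B =
        ⋃ v ∈ (Finset.univ.filter fun v : Fin n → M => g v ∈ B),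
          ⋂ k ∈ (Finset.univ : Finset (Fin n)), a k ⁻¹' {v k} := by
      ext i
      simp only [Set.mem_preimage, Finset.mem_filter, Finset.mem_univ, true_and, Set.mem_iUnion,
        Set.mem_iInter, Set.mem_singleton_iff, exists_prop, true_implies]
      constructor
      · intro h
        exact ⟨fun k => a k i, h, fun k => rfl⟩
      · rintro ⟨v, hv, h⟩
        have : (fun k => a k i) = v := funext h
        rwa [this]
    rw [this]
    refine μ.isSetAlgebra.biUnion_mem _ fun v _ => μ.isSetAlgebra.biInter_mem _ fun k _ => ?_
    refine ha k _ ?_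
    let _ : MeasurableSpace M := borel M
    have : BorelSpace M := ⟨rfl⟩
    exact measurableSet_singleton _
  · have hw : ℵ₀ ≤ topologicalWeight M := self_le_add_left _ _
    -- unions of at most `w(M)` members
    have hUnion : ∀ S : Set (Set I), S ⊆ μ.algebra → #S ≤ topologicalWeight M →
        ⋃₀ S ∈ μ.algebra := by
      intro S hS hc
      have h1 : ⋂₀ (compl '' S) ∈ μ.algebra := by
        refine hcomp _ ?_ (Order.lt_succ_of_le (mk_image_le.trans hc))
        rintro _ ⟨s, hs, rfl⟩
        exact μ.isSetAlgebra.compl_mem (hS hs)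
      have h2 := μ.isSetAlgebra.compl_mem h1
      rwa [← Set.compl_sUnion, compl_compl] at h2
    let m : MeasurableSpace I :=
      { MeasurableSet' := fun s => s ∈ μ.algebra
        measurableSet_empty := μ.isSetAlgebra.empty_mem
        measurableSet_compl := fun s hs => μ.isSetAlgebra.compl_mem hs
        measurableSet_iUnion := fun f hf => by
          rw [← Set.sUnion_range]
          refine hUnion _ (by rintro _ ⟨k, rfl⟩; exact hf k) ?_
          exact (Cardinal.mk_le_aleph0_iff.2 (Set.countable_range f).to_subtype).trans hw }
    suffices h : @Measurable I M m (borel M) (fun i => g fun k => a k i) from h hB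
    refine measurable_generateFrom fun U hU => ?_
    change _ ∈ μ.algebra
    have hne : {c | ∃ O : Set (Set M), TopologicalSpace.IsTopologicalBasis O ∧ #O = c}.Nonempty :=
      ⟨_, _, TopologicalSpace.isTopologicalBasis_opens, rfl⟩
    obtain ⟨O, hO, hcard⟩ := csInf_mem hne
    have hOw : #O ≤ topologicalWeight M := by
      rw [hcard]
      exact self_le_add_right _ _
    let box : (Fin n → O) → Set I := fun b =>
      ⋂ k ∈ (Finset.univ : Finset (Fin n)), a k ⁻¹' (b k : Set M)
    have hbox : ∀ b, box b ∈ μ.algebra := fun b =>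
      μ.isSetAlgebra.biInter_mem _ fun k _ =>
        ha k _ (MeasurableSpace.measurableSet_generateFrom (hO.isOpen (b k).2))
    have heq : (fun i => g fun k => a k i) ⁻¹' U =
        ⋃₀ (box '' {b | (Set.univ.pi fun k => (b k : Set M)) ⊆ g ⁻¹' U}) := by
      ext i
      simp only [Set.mem_preimage, Set.mem_sUnion, Set.mem_image, Set.mem_ofPred_eq]
      constructor
      · intro hi
        have hopen : IsOpen (g ⁻¹' U) := IsOpen.preimage hg hU
        obtain ⟨u, hu, hsub⟩ := isOpen_pi_iff'.1 hopen (fun k => a k i) hi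
        have : ∀ k, ∃ o ∈ O, a k i ∈ o ∧ o ⊆ u k := fun k =>
          hO.exists_subset_of_mem_open (hu k).2 (hu k).1
        choose o ho hmem hou using this
        refine ⟨_, ⟨fun k => ⟨o k, ho k⟩, ?_, rfl⟩, ?_⟩
        · exact (Set.pi_mono fun k _ => hou k).trans hsub
        · simpa [box] using hmem
      · rintro ⟨_, ⟨b, hb, rfl⟩, hi⟩
        refine hb ?_
        simpa [box] using hi
    rw [heq]
    refine hUnion _ (by rintro _ ⟨b, -, rfl⟩; exact hbox b) (mk_image_le.trans ?_)
    refine (mk_set_le _).trans ?_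
    have h1 : #(Fin n → O) ≤ topologicalWeight M ^ (n : Cardinal.{z}) := by
      simpa using Cardinal.power_le_power_right (c := (n : Cardinal.{z})) hOw
    exact h1.trans (Cardinal.power_nat_le hw)

end ChargeSpace

/-! ### Powermeans -/

/-- The `𝒜`-measurable maps `I → M`. -/
def MeasurableMap {I : Type z} (μ : ChargeSpace I) (M : Type z) [TopologicalSpace M] : Type z :=
  {a : I → M // μ.IsMeasurableMap a}

namespace MeasurableMap

variable {I : Type z} (μ : ChargeSpace I) (M : Type z) [MetricSpace M] [DiamLEOne M]

/-- The pseudometric `d(a, b) = ∫ d(a_i, b_i) dμ`. -/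
noncomputable instance : PseudoMetricSpace (MeasurableMap μ M) where
  dist a b := μ.integral fun i => dist (a.1 i) (b.1 i)
  dist_self a := by simpa using μ.integral_const 0
  dist_comm a b := by simp only [dist_comm]
  dist_triangle a b c := by
    refine (μ.integral_mono (c := 0) (C := 1 + 1) (fun i => dist_nonneg) (fun i => ?_)
      fun i => dist_triangle (a.1 i) (b.1 i) (c.1 i)).trans ?_
    · exact add_le_add (DiamLEOne.dist_le_one _ _) (DiamLEOne.dist_le_one _ _)
    · exact μ.integral_add_le (c := 0) (C := 1) (fun i => dist_nonneg)
        (fun i => DiamLEOne.dist_le_one _ _) (fun i => dist_nonneg)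
        (fun i => DiamLEOne.dist_le_one _ _)

instance : DiamLEOne (MeasurableMap μ M) where
  dist_le_one _ _ := μ.integral_le_const (c := 0) (fun _ => dist_nonneg)
    fun _ => DiamLEOne.dist_le_one _ _

end MeasurableMap

theorem Prestructure.continuous_func (L : LipschitzLanguage.{u, v, w}) {M : Type z}
    [PseudoMetricSpace M] [DiamLEOne M] [Prestructure L M] (F : L.Func) :
    Continuous (Prestructure.func (M := M) F) := by
  rw [continuous_iff_continuousAt]
  intro b
  rw [ContinuousAt, tendsto_iff_dist_tendsto_zero]
  refine squeeze_zero (fun _ => dist_nonneg) (fun a => Prestructure.func_lip F a b) ?_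
  have : Continuous fun a : Fin (L.funcArity F) → M =>
      (L.funcLip F : ℝ) * ∑ k, dist (a k) (b k) := by fun_prop
  simpa using this.tendsto b

/-- The pointwise prestructure on the measurable maps, with `R(a) = ∫ R^M(a_i) dμ`. -/
noncomputable instance MeasurableMap.prestructure (L : LipschitzLanguage.{u, v, w}) {I : Type z}
    (μ : ChargeSpace I) (M : Type z) [MetricSpace M] [DiamLEOne M] [Prestructure L M]
    [μ.IsMeanable M] : Prestructure L (MeasurableMap μ M) where
  const c := ⟨fun _ => Prestructure.const c, .const μ _⟩
  func F a := ⟨fun i => Prestructure.func F fun k => (a k).1 i,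
    .comp μ _ (Prestructure.continuous_func L F) (fun k => (a k).1) fun k => (a k).2⟩
  rel R a := μ.integral fun i => Prestructure.rel R fun k => (a k).1 i
  func_lip F a b := by
    have hsum : ∀ i, ∑ k, dist ((a k).1 i) ((b k).1 i) ≤ L.funcArity F := fun i =>
      (Finset.sum_le_sum fun k _ => DiamLEOne.dist_le_one _ _).trans (by simp)
    have hsum0 : ∀ i, 0 ≤ ∑ k, dist ((a k).1 i) ((b k).1 i) := fun i =>
      Finset.sum_nonneg fun k _ => dist_nonneg
    refine (μ.integral_mono (c := 0) (C := L.funcLip F * L.funcArity F) (fun i => dist_nonneg)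
      (fun i => mul_le_mul_of_nonneg_left (hsum i) (L.funcLip F).2)
      fun i => Prestructure.func_lip F (fun k => (a k).1 i) fun k => (b k).1 i).trans ?_
    refine (μ.integral_smul_le (L.funcLip F).2 hsum0 hsum).trans ?_
    exact mul_le_mul_of_nonneg_left (μ.integral_sum_le _ (fun k i => dist_nonneg)
      fun k i => DiamLEOne.dist_le_one _ _) (L.funcLip F).2
  rel_mem R a :=
    ⟨μ.const_le_integral (fun _ => (Prestructure.rel_mem R _).1)
        fun _ => (Prestructure.rel_mem R _).2,
      μ.integral_le_const (fun _ => (Prestructure.rel_mem R _).1)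
        fun _ => (Prestructure.rel_mem R _).2⟩
  rel_lip R a b := by
    have hsum : ∀ i, ∑ k, dist ((a k).1 i) ((b k).1 i) ≤ L.relArity R := fun i =>
      (Finset.sum_le_sum fun k _ => DiamLEOne.dist_le_one _ _).trans (by simp)
    have hsum0 : ∀ i, 0 ≤ ∑ k, dist ((a k).1 i) ((b k).1 i) := fun i =>
      Finset.sum_nonneg fun k _ => dist_nonneg
    have hs : ∀ i, (L.relLip R : ℝ) * ∑ k, dist ((a k).1 i) ((b k).1 i) ≤
        L.relLip R * L.relArity R := fun i => mul_le_mul_of_nonneg_left (hsum i) (L.relLip R).2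
    have hs0 : ∀ i, 0 ≤ (L.relLip R : ℝ) * ∑ k, dist ((a k).1 i) ((b k).1 i) := fun i =>
      mul_nonneg (L.relLip R).2 (hsum0 i)
    have hpos : (0 : ℝ) ≤ L.relLip R * L.relArity R :=
      mul_nonneg (L.relLip R).2 (Nat.cast_nonneg _)
    have h1 : ∀ i, (Prestructure.rel R fun k => (b k).1 i) ≤ (1 : ℝ) := fun i =>
      (Prestructure.rel_mem R _).2
    rw [sub_le_iff_le_add']
    refine (μ.integral_mono (c := 0) (C := 1 + L.relLip R * L.relArity R)
      (fun i => (Prestructure.rel_mem R _).1) (fun i => add_le_add (h1 i) (hs i))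
      fun i => sub_le_iff_le_add'.1
        (Prestructure.rel_lip R (fun k => (a k).1 i) fun k => (b k).1 i)).trans ?_
    refine (μ.integral_add_le (c := 0) (C := 1 + L.relLip R * L.relArity R)
      (fun i => (Prestructure.rel_mem R _).1) (fun i => (h1 i).trans (by linarith)) hs0
      (fun i => (hs i).trans (by linarith))).trans ?_
    refine add_le_add le_rfl ((μ.integral_smul_le (L.relLip R).2 hsum0 hsum).trans ?_)
    exact mul_le_mul_of_nonneg_left (μ.integral_sum_le _ (fun k i => dist_nonneg)
      fun k i => DiamLEOne.dist_le_one _ _) (L.relLip R).2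

instance (X : Type z) [PseudoMetricSpace X] [DiamLEOne X] : DiamLEOne (SeparationQuotient X) where
  dist_le_one a b := by
    obtain ⟨x, rfl⟩ := SeparationQuotient.surjective_mk a
    obtain ⟨y, rfl⟩ := SeparationQuotient.surjective_mk b
    exact DiamLEOne.dist_le_one x y

/-- The quotient of a prestructure by the relation `d(a, b) = 0`. The operations are computed on
representatives; see `SeparationQuotient.func_mk` and `SeparationQuotient.rel_mk` for the
independence of their choice. -/
noncomputable instance SeparationQuotient.prestructure (L : LipschitzLanguage.{u, v, w})
    (X : Type z) [PseudoMetricSpace X] [DiamLEOne X] [Prestructure L X] :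
    Prestructure L (SeparationQuotient X) where
  const c := SeparationQuotient.mk (Prestructure.const c)
  func F a := SeparationQuotient.mk (Prestructure.func F fun k => Quotient.out (a k))
  rel R a := Prestructure.rel R fun k => Quotient.out (a k)
  func_lip F a b := by
    have h : ∀ x y : SeparationQuotient X, dist x y = dist (Quotient.out x) (Quotient.out y) := by
      intro x y
      conv_lhs => rw [← Quotient.out_eq x, ← Quotient.out_eq y]
      rfl
    simp only [h (a _) (b _), SeparationQuotient.dist_mk]
    exact Prestructure.func_lip F _ _
  rel_mem R a := Prestructure.rel_mem R _
  rel_lip R a b := by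
    have h : ∀ x y : SeparationQuotient X, dist x y = dist (Quotient.out x) (Quotient.out y) := by
      intro x y
      conv_lhs => rw [← Quotient.out_eq x, ← Quotient.out_eq y]
      rfl
    simp only [h (a _) (b _)]
    exact Prestructure.rel_lip R _ _

theorem SeparationQuotient.dist_out {X : Type z} [PseudoMetricSpace X] (x : X) :
    dist (Quotient.out (SeparationQuotient.mk x)) x = 0 := by
  rw [← SeparationQuotient.dist_mk, dist_eq_zero]
  exact Quotient.out_eq (SeparationQuotient.mk x)

section Quotient

variable (L : LipschitzLanguage.{u, v, w}) {X : Type z} [PseudoMetricSpace X] [DiamLEOne X]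
  [Prestructure L X]

theorem SeparationQuotient.func_mk (F : L.Func) (a : Fin (L.funcArity F) → X) :
    Prestructure.func F (fun k => SeparationQuotient.mk (a k)) =
      SeparationQuotient.mk (Prestructure.func F a) := by
  change SeparationQuotient.mk _ = _
  rw [← dist_eq_zero, SeparationQuotient.dist_mk]
  refine le_antisymm ((Prestructure.func_lip F _ _).trans ?_) dist_nonneg
  simp [SeparationQuotient.dist_out]

theorem SeparationQuotient.rel_mk (R : L.Rel) (a : Fin (L.relArity R) → X) :
    Prestructure.rel R (fun k => SeparationQuotient.mk (a k)) = Prestructure.rel R a := by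
  change Prestructure.rel R (fun k => Quotient.out (SeparationQuotient.mk (a k))) = _
  have h1 := Prestructure.rel_lip R (fun k => Quotient.out (SeparationQuotient.mk (a k))) a
  have h2 := Prestructure.rel_lip R a (fun k => Quotient.out (SeparationQuotient.mk (a k)))
  simp only [dist_comm (a _), SeparationQuotient.dist_out, Finset.sum_const_zero, mul_zero]
    at h1 h2
  linarith

end Quotient

/-- The powermean `M^μ`: measurable maps `I → M` modulo `∫ d(a_i, b_i) dμ = 0`. It is not
completed. -/
abbrev Powermean {I : Type z} (μ : ChargeSpace I) (M : Type z) [MetricSpace M] [DiamLEOne M] :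
    Type z :=
  SeparationQuotient (MeasurableMap μ M)

/-! ### Means on bounded functions -/

/-! The index set is a power `I = M^C`, the algebra consists of the sets depending on at most `κ`
coordinates, and the charge comes from a mean `F`, a positive normalized functional on bounded
functions. As `M` has a basis of at most `κ` open sets, a map `I → M` is measurable exactly when it
depends on at most `κ` coordinates (`isMeasurableMap_meanCharge_iff`). Measurability therefore
imposes no regularity, and any pointwise choice made from at most `κ` measurable maps is again
measurable.

This yields a Łoś theorem (`Formula.realize_eq_map`): the value of an affine formula in the
powermean is the mean of its pointwise values. Addition and scalars are linearity of `F`; for `inf`,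
an ε-optimal witness is chosen pointwise as a function of the parameters.

Saturation is built into `F`. The parameters of a type `p` over `A` are represented by functions of
`κ` coordinates, listed by some `e : K → C` with `|K| = κ`. Then `p` becomes a linear subspace `q`
of pairs `(h, r)`, demanding that a new point `x` satisfy `F (h(s, x)) = r`, where `s` is the
restriction of the index along `e`. The tree `Coord` has a coordinate `mk e q` for every such pair.
Since `q` speaks of functions on `(K → M) × M` and not on `I`, the definition is not circular, and
since `q` ranges over all subspaces, neither the tree nor the mean depends on the language.

The demand is consistent when `F (inf_x h(s, x)) ≤ r` on `q`; as `q` is closed under negation this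
also gives the upper bound. For a type, consistency follows from the Łoś theorem for `inf` and
positivity of `p`. A consistent demand can be met by extending `F` to functions of the new
coordinate (`exists_solution_of_consistent`): if `g + h(s, x) ≥ 0` for all values `x` of the free
coordinate, then `g + inf_x h(s, x) ≥ 0`, hence `F g + r ≥ 0`, and M. Riesz extension applies.
Zorn's lemma, with ultralimits of means along chains, gives one mean solving all the demands
consistent with it (`exists_isMean_solved`). The coordinate function of `mk e q` then realizes `p`.
-/

/-- The submodule of bounded real functions. -/
def boundedFunctions (I : Type*) : Submodule ℝ (I → ℝ) where
  carrier := {f | ∃ C, ∀ i, |f i| ≤ C}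
  add_mem' := by
    rintro f g ⟨C, hC⟩ ⟨D, hD⟩
    exact ⟨C + D, fun i => (abs_add_le _ _).trans (add_le_add (hC i) (hD i))⟩
  zero_mem' := ⟨0, by simp⟩
  smul_mem' := by
    rintro r f ⟨C, hC⟩
    exact ⟨|r| * C, fun i => by
      simpa [abs_mul] using mul_le_mul_of_nonneg_left (hC i) (abs_nonneg r)⟩

theorem const_mem_boundedFunctions {I : Type*} (c : ℝ) : (fun _ : I => c) ∈ boundedFunctions I :=
  ⟨|c|, fun _ => le_rfl⟩

/-- A mean on `I`: a linear functional which is positive on bounded functions and normalized. Its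
values on unbounded functions are irrelevant. -/
structure IsMean {I : Type*} (F : (I → ℝ) →ₗ[ℝ] ℝ) : Prop where
  map_one : F (fun _ => 1) = 1
  nonneg : ∀ f ∈ boundedFunctions I, (∀ i, 0 ≤ f i) → 0 ≤ F f

namespace IsMean

variable {I : Type*} {F : (I → ℝ) →ₗ[ℝ] ℝ}

theorem mono (hF : IsMean F) {f g : I → ℝ} (hf : f ∈ boundedFunctions I)
    (hg : g ∈ boundedFunctions I) (h : ∀ i, f i ≤ g i) : F f ≤ F g := by
  have := hF.nonneg (g - f) (Submodule.sub_mem _ hg hf) fun i => sub_nonneg.2 (h i)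
  rw [map_sub] at this
  linarith

theorem map_const (hF : IsMean F) (c : ℝ) : F (fun _ => c) = c := by
  have h : (fun _ : I => c) = c • fun _ => (1 : ℝ) := by
    funext i
    simp
  rw [h, map_smul, hF.map_one, smul_eq_mul, mul_one]

theorem abs_le (hF : IsMean F) {f : I → ℝ} {C : ℝ} (hC : ∀ i, |f i| ≤ C) : |F f| ≤ C := by
  have hf : f ∈ boundedFunctions I := ⟨C, hC⟩
  refine _root_.abs_le.2 ⟨?_, ?_⟩
  · have := hF.mono (const_mem_boundedFunctions (-C)) hf fun i => (_root_.abs_le.1 (hC i)).1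
    rwa [hF.map_const] at this
  · have := hF.mono hf (const_mem_boundedFunctions C) fun i => (_root_.abs_le.1 (hC i)).2
    rwa [hF.map_const] at this

/-- Evaluation at a point is a mean. -/
theorem proj (i : I) : IsMean (LinearMap.proj i : (I → ℝ) →ₗ[ℝ] ℝ) :=
  ⟨rfl, fun _ _ h => h i⟩

/-- A positive normalized functional, given in coordinates on a space of bounded functions,
extends to a mean. -/
theorem exists_extension {W : Type*} [AddCommGroup W] [Module ℝ W] (T : W →ₗ[ℝ] (I → ℝ))
    (l : W →ₗ[ℝ] ℝ) (hT : ∀ x, T x ∈ boundedFunctions I)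
    (hpos : ∀ x, (∀ i, 0 ≤ T x i) → 0 ≤ l x) (e : W) (he : T e = fun _ => 1) (hle : l e = 1) :
    ∃ F : (I → ℝ) →ₗ[ℝ] ℝ, IsMean F ∧ ∀ x, F (T x) = l x := by
  let T' : W →ₗ[ℝ] boundedFunctions I := T.codRestrict _ hT
  have hT' : ∀ x, ((T' x : boundedFunctions I) : I → ℝ) = T x := fun x => rfl
  -- Positivity applied to `x` and to `-x` makes `l` vanish where `T` does, so `l` descends to the
  -- range of `T`.
  have hker : LinearMap.ker T' ≤ LinearMap.ker l := by
    intro x hx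
    rw [LinearMap.mem_ker] at hx ⊢
    have h0 : T x = 0 := by rw [← hT', hx]; rfl
    have h1 := hpos x (by simp [h0])
    have h2 := hpos (-x) (by simp [h0])
    rw [map_neg] at h2
    linarith
  let f : boundedFunctions I →ₗ.[ℝ] ℝ :=
    ⟨LinearMap.range T', ((LinearMap.ker T').liftQ l hker).comp
      (T'.quotKerEquivRange.symm : LinearMap.range T' →ₗ[ℝ] _)⟩
  have hf : ∀ x (h : T' x ∈ f.domain), f ⟨T' x, h⟩ = l x := by
    intro x h
    change ((LinearMap.ker T').liftQ l hker) (T'.quotKerEquivRange.symm ⟨T' x, h⟩) = l x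
    rw [LinearMap.quotKerEquivRange_symm_apply_image]
    simp
  let s : PointedCone ℝ (boundedFunctions I) :=
    { carrier := {g | ∀ i, 0 ≤ g.1 i}
      add_mem' := fun {a b} ha hb i => add_nonneg (ha i) (hb i)
      zero_mem' := fun i => le_rfl
      smul_mem' := fun c g hg i => mul_nonneg c.2 (hg i) }
  obtain ⟨g, hg, hgs⟩ := riesz_extension s f
    (by
      rintro ⟨_, x, rfl⟩ hx
      exact (hpos x hx).trans_eq (hf x _).symm)
    (by
      rintro ⟨y, C, hC⟩
      -- The constants lie in the range of `T`, so every bounded function is dominated from there: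
      -- this is the cofinality needed for the Riesz extension.
      refine ⟨⟨T' (C • e), C • e, rfl⟩, fun i => ?_⟩
      change 0 ≤ T (C • e) i + y i
      have := (_root_.abs_le.1 (hC i)).1
      rw [map_smul, he]
      simp only [Pi.smul_apply, smul_eq_mul, mul_one]
      linarith)
  -- The extension to unbounded functions is an arbitrary linear one.
  obtain ⟨F, hF⟩ := LinearMap.exists_extend g
  have hFg : ∀ y (hy : y ∈ boundedFunctions I), F y = g ⟨y, hy⟩ := by
    intro y hy
    rw [← hF]
    rfl
  have hFT : ∀ x, F (T x) = l x := by
    intro x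
    rw [hFg _ (hT x)]
    exact (hg ⟨T' x, x, rfl⟩).trans (hf x _)
  refine ⟨F, ⟨?_, ?_⟩, hFT⟩
  · rw [← he, hFT, hle]
  · intro y hy h
    rw [hFg _ hy]
    exact hgs _ h

/-- Pointwise limits of means along an ultrafilter. -/
theorem exists_ultralimit {J : Type*} (U : Ultrafilter J) (F : J → (I → ℝ) →ₗ[ℝ] ℝ)
    (hF : ∀ j, IsMean (F j)) :
    ∃ G : (I → ℝ) →ₗ[ℝ] ℝ, IsMean G ∧
      ∀ f ∈ boundedFunctions I, Filter.Tendsto (fun j => F j f) U (𝓝 (G f)) := by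
  have hlim : ∀ f : boundedFunctions I, ∃ x, Filter.Tendsto (fun j => F j f.1) U (𝓝 x) := by
    rintro ⟨f, C, hC⟩
    have hmem : ∀ j, F j f ∈ Icc (-C) C := fun j => _root_.abs_le.1 ((hF j).abs_le hC)
    obtain ⟨x, -, hx⟩ := (isCompact_Icc (a := -C) (b := C)).ultrafilter_le_nhds'
      (U.map fun j => F j f) (Filter.univ_mem' (f := (U : Filter J)) hmem)
    exact ⟨x, hx⟩
  choose g hg using hlim
  -- Linearity passes to the limit by uniqueness of limits.
  let g' : boundedFunctions I →ₗ[ℝ] ℝ :=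
    { toFun := g
      map_add' := fun a b => tendsto_nhds_unique (hg (a + b)) (by
        simpa using (hg a).add (hg b))
      map_smul' := fun r a => tendsto_nhds_unique (hg (r • a)) (by
        simpa using (hg a).const_mul r) }
  obtain ⟨G, hG⟩ := LinearMap.exists_extend g'
  have hGg : ∀ y (hy : y ∈ boundedFunctions I), G y = g ⟨y, hy⟩ := by
    intro y hy
    have : G y = g' ⟨y, hy⟩ := by
      rw [← hG]
      rfl
    exact this
  refine ⟨G, ⟨?_, ?_⟩, ?_⟩
  · rw [hGg _ (const_mem_boundedFunctions 1)]
    exact tendsto_nhds_unique (hg _) (by simp [(hF _).map_one])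
  · intro f hf h
    rw [hGg _ hf]
    exact ge_of_tendsto' (hg ⟨f, hf⟩) fun j => (hF j).nonneg f hf h
  · intro f hf
    rw [hGg _ hf]
    exact hg ⟨f, hf⟩

end IsMean

/-! ### Coordinates labelled by extension problems -/

/-- A tree of coordinates: each coordinate other than the base one is labelled by a family of
earlier coordinates and an element of `Q`. -/
inductive Coord (K : Type z) (Q : Type z) : Type z
  | base : Coord K Q
  | mk (e : K → Coord K Q) (q : Q) : Coord K Q

/-- An extension problem: the graph of a linear functional on functions of `(s, x)`, where `x` is
a new variable and `s` lists the old ones. -/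
abbrev ExtensionProblem (K M : Type z) : Type z :=
  Submodule ℝ (((K → M) → M → ℝ) × ℝ)

/-- The points whose coordinates range over all extension problems. -/
abbrev Point (K M : Type z) : Type z :=
  Coord K (ExtensionProblem K M) → M

section Tower

variable {K M : Type z}

/-- The extension problem `q` in the variables `e` is consistent with the mean `F`. -/
def Consistent (F : (Point K M → ℝ) →ₗ[ℝ] ℝ) (e : K → Coord K (ExtensionProblem K M))
    (q : ExtensionProblem K M) : Prop :=
  ∀ h ∈ q, (∃ C, ∀ s x, |h.1 s x| ≤ C) ∧ F (fun i => ⨅ x, h.1 (fun k => i (e k)) x) ≤ h.2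

/-- The coordinate of an extension problem solves this problem. -/
def Solved (F : (Point K M → ℝ) →ₗ[ℝ] ℝ) (e : K → Coord K (ExtensionProblem K M))
    (q : ExtensionProblem K M) : Prop :=
  ∀ h ∈ q, F (fun i => h.1 (fun k => i (e k)) (i (.mk e q))) = h.2

/-- A set of coordinates containing all predecessors of its members, and a mean solving all the
consistent problems in this set. -/
structure IsPartialSolution (D : Set (Coord K (ExtensionProblem K M)))
    (F : (Point K M → ℝ) →ₗ[ℝ] ℝ) : Prop where
  isMean : IsMean F
  mem_of_mk_mem : ∀ e q, Coord.mk e q ∈ D → ∀ k, e k ∈ D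
  solved : ∀ e q, Coord.mk e q ∈ D → Consistent F e q → Solved F e q

/-- The two means agree on the bounded functions of the coordinates in `D`. -/
def AgreeOn (D : Set (Coord K (ExtensionProblem K M))) (F G : (Point K M → ℝ) →ₗ[ℝ] ℝ) : Prop :=
  ∀ f ∈ boundedFunctions (Point K M), DependsOn f D → F f = G f

theorem abs_iInf_le [Nonempty M] {f : M → ℝ} {C : ℝ} (h : ∀ x, |f x| ≤ C) : |⨅ x, f x| ≤ C := by
  have hb : BddBelow (range f) := ⟨-C, by rintro _ ⟨x, rfl⟩; exact (abs_le.1 (h x)).1⟩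
  inhabit M
  exact abs_le.2 ⟨le_ciInf fun x => (abs_le.1 (h x)).1,
    (ciInf_le hb default).trans (abs_le.1 (h _)).2⟩

/-- Consistency is tested only on the functions `inf_x h(s, x)`, which are bounded and read only the
coordinates `e k`. Later changes of the mean outside `D` therefore cannot affect it. -/
theorem Consistent.congr [Nonempty M] {D : Set (Coord K (ExtensionProblem K M))}
    {F G : (Point K M → ℝ) →ₗ[ℝ] ℝ} (hFG : AgreeOn D F G)
    {e : K → Coord K (ExtensionProblem K M)} {q : ExtensionProblem K M} (he : ∀ k, e k ∈ D)
    (h : Consistent F e q) : Consistent G e q := by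
  intro a ha
  obtain ⟨⟨C, hC⟩, h2⟩ := h a ha
  refine ⟨⟨C, hC⟩, ?_⟩
  rwa [← hFG _ ⟨C, fun i => abs_iInf_le (hC _)⟩]
  intro i j hij
  have : (fun k => i (e k)) = fun k => j (e k) := funext fun k => hij _ (he k)
  simp only [this]

/-- `D` contains the predecessors of its members, so both the consistency and the solution of a
problem in `D` involve only functions on which the two means agree. -/
theorem IsPartialSolution.congr [Nonempty M] {D : Set (Coord K (ExtensionProblem K M))}
    {F G : (Point K M → ℝ) →ₗ[ℝ] ℝ} (hF : IsPartialSolution D F) (hG : IsMean G)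
    (hFG : AgreeOn D F G) : IsPartialSolution D G := by
  refine ⟨hG, hF.mem_of_mk_mem, fun e q hq hcons => ?_⟩
  have he := hF.mem_of_mk_mem e q hq
  intro a ha
  have hGF : AgreeOn D G F := fun f h1 h2 => (hFG f h1 h2).symm
  have hsol := hF.solved e q hq (hcons.congr hGF he) a ha
  obtain ⟨⟨C, hC⟩, -⟩ := hcons a ha
  rw [← hsol]
  refine hGF _ ⟨C, fun i => hC _ _⟩ fun i j hij => ?_
  have : (fun k => i (e k)) = fun k => j (e k) := funext fun k => hij _ (he k)
  simp only [this, hij _ hq]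

/-- Bounded functions of the coordinates in `D`. -/
def boundedFunctionsOn (D : Set (Coord K (ExtensionProblem K M))) :
    Submodule ℝ (Point K M → ℝ) where
  carrier := {f | f ∈ boundedFunctions (Point K M) ∧ DependsOn f D}
  add_mem' := by
    rintro f g ⟨hf, hf'⟩ ⟨hg, hg'⟩
    refine ⟨Submodule.add_mem _ hf hg, fun i j hij => ?_⟩
    rw [Pi.add_apply, Pi.add_apply, hf' hij, hg' hij]
  zero_mem' := ⟨Submodule.zero_mem _, fun i j _ => rfl⟩
  smul_mem' := by
    rintro r f ⟨hf, hf'⟩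
    refine ⟨Submodule.smul_mem _ r hf, fun i j hij => ?_⟩
    rw [Pi.smul_apply, Pi.smul_apply, hf' hij]

/-- A consistent problem in old coordinates can be solved by changing the mean only on the
functions that depend on the new coordinate. -/
theorem exists_solution_of_consistent [Nonempty M] {D : Set (Coord K (ExtensionProblem K M))}
    {F : (Point K M → ℝ) →ₗ[ℝ] ℝ} (hF : IsMean F) {e : K → Coord K (ExtensionProblem K M)}
    {q : ExtensionProblem K M} (he : ∀ k, e k ∈ D) (hc : Coord.mk e q ∉ D)
    (h : Consistent F e q) :
    ∃ G : (Point K M → ℝ) →ₗ[ℝ] ℝ, IsMean G ∧ AgreeOn D F G ∧ Solved G e q := by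
  classical
  let S : q →ₗ[ℝ] (Point K M → ℝ) :=
    { toFun := fun a i => a.1.1 (fun k => i (e k)) (i (.mk e q))
      map_add' := fun _ _ => rfl
      map_smul' := fun _ _ => rfl }
  -- A pair `(g, a)` stands for `g` plus `a` evaluated at the new coordinate, and `l` prescribes its
  -- mean: the old one on `g`, the demanded one on `a`.
  let T : (boundedFunctionsOn D × q) →ₗ[ℝ] (Point K M → ℝ) :=
    (boundedFunctionsOn D).subtype.coprod S
  let l : (boundedFunctionsOn D × q) →ₗ[ℝ] ℝ :=
    (F.comp (boundedFunctionsOn D).subtype).coprod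
      ((LinearMap.snd ℝ ((K → M) → M → ℝ) ℝ).comp q.subtype)
  have hT : ∀ g a i, T (g, a) i = g.1 i + a.1.1 (fun k => i (e k)) (i (.mk e q)) := by
    intro g a i
    simp [T, S]
  have hl : ∀ g a, l (g, a) = F g.1 + a.1.2 := by
    intro g a
    simp [l]
  obtain ⟨G, hG, hGT⟩ := IsMean.exists_extension T l
    (by
      rintro ⟨⟨g, hg, hg'⟩, ⟨a, ha⟩⟩
      obtain ⟨⟨C, hC⟩, -⟩ := h a ha
      have : T (⟨g, hg, hg'⟩, ⟨a, ha⟩) =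
          g + fun i => a.1 (fun k => i (e k)) (i (.mk e q)) := by
        funext i
        rw [hT]
        rfl
      rw [this]
      exact Submodule.add_mem _ hg ⟨C, fun i => hC _ _⟩)
    (by
      rintro ⟨⟨g, hg, hg'⟩, ⟨a, ha⟩⟩ hpos
      obtain ⟨⟨C, hC⟩, hinf⟩ := h a ha
      rw [hl]
      have hb : (fun i : Point K M => ⨅ x, a.1 (fun k => i (e k)) x) ∈
          boundedFunctions (Point K M) := ⟨C, fun i => abs_iInf_le (hC _)⟩
      have h0 : 0 ≤ F (g + fun i : Point K M => ⨅ x, a.1 (fun k => i (e k)) x) := by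
        refine hF.nonneg _ (Submodule.add_mem _ hg hb) fun i => ?_
        change 0 ≤ g i + ⨅ x, a.1 (fun k => i (e k)) x
        rw [← neg_le_iff_add_nonneg']
        refine le_ciInf fun x => ?_
        -- The new coordinate lies outside `D`: moving it to `x` changes neither `g` nor the old
        -- variables, so positivity holds for every `x` and passes to the infimum.
        have h1 := hpos (Function.update i (.mk e q) x)
        rw [hT] at h1
        have h2 : g (Function.update i (.mk e q) x) = g i := by
          refine hg' fun c hcD => Function.update_of_ne ?_ _ _
          rintro rfl
          exact hc hcD
        have h3 : (fun k => Function.update i (.mk e q) x (e k)) = fun k => i (e k) := by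
          funext k
          refine Function.update_of_ne ?_ _ _
          intro hk
          exact hc (hk ▸ he k)
        simp only [h2, h3, Function.update_self] at h1
        linarith
      rw [map_add] at h0
      linarith)
    (⟨fun _ => 1, const_mem_boundedFunctions 1, fun _ _ _ => rfl⟩, 0)
    (by
      funext i
      rw [hT]
      simp)
    (by
      rw [hl]
      simp [hF.map_one])
  refine ⟨G, hG, fun f hf hf' => ?_, fun a ha => ?_⟩
  · have h1 := hGT (⟨f, hf, hf'⟩, 0)
    rw [hl] at h1
    have h2 : T (⟨f, hf, hf'⟩, 0) = f := by
      funext i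
      rw [hT]
      simp
    rw [h2] at h1
    simp [h1]
  · have h1 := hGT (0, ⟨a, ha⟩)
    rw [hl] at h1
    have h2 : T (0, ⟨a, ha⟩) = fun i => a.1 (fun k => i (e k)) (i (.mk e q)) := by
      funext i
      rw [hT]
      simp
    rw [h2] at h1
    simpa using h1

/-- At the base coordinate, or at an inconsistent problem, nothing is demanded and the mean is kept;
otherwise the one-step extension is used. -/
theorem IsPartialSolution.insert [Nonempty M] {D : Set (Coord K (ExtensionProblem K M))}
    {F : (Point K M → ℝ) →ₗ[ℝ] ℝ} (hF : IsPartialSolution D F)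
    (c : Coord K (ExtensionProblem K M)) (hc : c ∉ D)
    (hpred : ∀ e q, c = .mk e q → ∀ k, e k ∈ D) :
    ∃ G : (Point K M → ℝ) →ₗ[ℝ] ℝ, IsPartialSolution (insert c D) G ∧ AgreeOn D F G := by
  obtain ⟨G, hG, hFG, hsol⟩ : ∃ G : (Point K M → ℝ) →ₗ[ℝ] ℝ, IsMean G ∧ AgreeOn D F G ∧
      ∀ e q, c = .mk e q → Consistent G e q → Solved G e q := by
    by_cases h : ∃ e q, c = .mk e q ∧ Consistent F e q
    · obtain ⟨e, q, rfl, hcons⟩ := h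
      obtain ⟨G, hG, hFG, hsol⟩ :=
        exists_solution_of_consistent hF.isMean (hpred e q rfl) hc hcons
      refine ⟨G, hG, hFG, ?_⟩
      rintro e' q' heq -
      cases heq
      exact hsol
    · refine ⟨F, hF.isMean, fun _ _ _ => rfl, fun e q heq hcons => ?_⟩
      exact absurd ⟨e, q, heq, hcons⟩ h
  have hG' := hF.congr hG hFG
  refine ⟨G, ⟨hG, ?_, ?_⟩, hFG⟩
  · rintro e q (heq | hD) k
    · exact mem_insert_of_mem _ (hpred e q heq.symm k)
    · exact mem_insert_of_mem _ (hF.mem_of_mk_mem e q hD k)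
  · rintro e q (heq | hD)
    · exact hsol e q heq.symm
    · exact hG'.solved e q hD

variable (K M) in
/-- There is a mean on the points that solves all the extension problems consistent with it. -/
theorem exists_isMean_solved [Nonempty M] :
    ∃ F : (Point K M → ℝ) →ₗ[ℝ] ℝ, IsMean F ∧ ∀ e q, Consistent F e q → Solved F e q := by
  classical
  let P := {x : Set (Coord K (ExtensionProblem K M)) × ((Point K M → ℝ) →ₗ[ℝ] ℝ) //
    IsPartialSolution x.1 x.2}
  let r : P → P → Prop := fun x y => x.1.1 ⊆ y.1.1 ∧ AgreeOn x.1.1 x.1.2 y.1.2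
  have hrefl : ∀ x, r x x := fun x => ⟨Subset.rfl, fun _ _ _ => rfl⟩
  have htrans : ∀ {a b c : P}, r a b → r b c → r a c := by
    intro a b c hab hbc
    exact ⟨hab.1.trans hbc.1, fun f hf hd => (hab.2 f hf hd).trans
      (hbc.2 f hf fun i j hij => hd fun k hk => hij k (hab.1 hk))⟩
  obtain ⟨⟨⟨D, F⟩, hDF⟩, hmax⟩ := exists_maximal_of_chains_bounded (r := r) (by
    intro c hchain
    inhabit M
    rcases c.eq_empty_or_nonempty with rfl | ⟨x0, hx0⟩
    -- The empty chain is bounded by evaluation at a constant point, with no coordinates treated.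
    · exact ⟨⟨(∅, LinearMap.proj fun _ => default), IsMean.proj _,
        fun _ _ h => absurd h (notMem_empty _), fun _ _ h => absurd h (notMem_empty _)⟩, by simp⟩
    have htot : ∀ x ∈ c, ∀ y ∈ c, r x y ∨ r y x := by
      intro x hx y hy
      by_cases hxy : x = y
      · subst hxy
        exact Or.inl (hrefl x)
      · exact hchain hx hy hxy
    let B : c → Set c := fun x => {y | r x.1 y.1}
    -- The filter of tails of the chain. On a function depending on the coordinates of `x`, the
    -- means of the chain are constant from `x` on, so the ultralimit agrees with the mean of `x`.
    let l : Filter c := ⨅ x, Filter.principal (B x)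
    have : Nonempty c := ⟨⟨x0, hx0⟩⟩
    have hl : l.NeBot := by
      refine Filter.iInf_neBot_of_directed' ?_ fun x =>
        Filter.principal_neBot_iff.2 ⟨x, hrefl _⟩
      intro x y
      rcases htot x x.2 y y.2 with h | h
      · exact ⟨y, Filter.principal_mono.2 fun z hz => htrans h hz, le_rfl⟩
      · exact ⟨x, le_rfl, Filter.principal_mono.2 fun z hz => htrans h hz⟩
    obtain ⟨G, hG, hlim⟩ := IsMean.exists_ultralimit (Ultrafilter.of l)
      (fun x : c => x.1.1.2) fun x => x.1.2.isMean
    have hagree : ∀ x : c, AgreeOn x.1.1.1 x.1.1.2 G := by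
      intro x f hf hd
      refine tendsto_nhds_unique ?_ (hlim f hf)
      refine tendsto_const_nhds.congr' ?_
      have hB : B x ∈ (Ultrafilter.of l : Filter c) :=
        Ultrafilter.of_le l (Filter.mem_iInf_of_mem x (Filter.mem_principal_self _))
      filter_upwards [hB] with y hy
      exact hy.2 f hf hd
    refine ⟨⟨(⋃ x : c, x.1.1.1, G), hG, ?_, ?_⟩, fun x hx => ⟨?_, hagree ⟨x, hx⟩⟩⟩
    · intro e q hq k
      obtain ⟨x, hx⟩ := mem_iUnion.1 hq
      exact mem_iUnion.2 ⟨x, x.1.2.mem_of_mk_mem e q hx k⟩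
    · intro e q hq
      obtain ⟨x, hx⟩ := mem_iUnion.1 hq
      exact (x.1.2.congr hG (hagree x)).solved e q hx
    · exact subset_iUnion (fun x : c => x.1.1.1) ⟨x, hx⟩) htrans
  have hext : ∀ c, (∀ e q, c = .mk e q → ∀ k, e k ∈ D) → c ∈ D := by
    intro c hpred
    by_contra hc
    obtain ⟨G, hG, hFG⟩ := hDF.insert c hc hpred
    exact hc ((hmax ⟨(insert c D, G), hG⟩ ⟨subset_insert _ _, hFG⟩).1 (mem_insert _ _))
  -- Well-foundedness of the tree: a maximal `D` contains each coordinate whose predecessors it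
  -- contains.
  have hall : ∀ c, c ∈ D := by
    intro c
    induction c with
    | base => exact hext _ (by simp)
    | mk e q ih =>
      refine hext _ ?_
      intro e' q' heq
      cases heq
      exact ih
  exact ⟨F, hDF.isMean, fun e q => hDF.solved e q (hall _)⟩

end Tower

/-! ### Functions of few coordinates -/

/-- The function depends on at most `κ` coordinates. -/
def DependsOnFew {C : Type z} {M : Type z} (κ : Cardinal.{z}) {β : Type*} (f : (C → M) → β) :
    Prop :=
  ∃ S : Set C, #S ≤ κ ∧ DependsOn f S

namespace DependsOnFew

variable {C M : Type z} {κ : Cardinal.{z}} {β γ : Type*}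

theorem const (b : β) : DependsOnFew κ fun _ : C → M => b :=
  ⟨∅, by simp, fun _ _ _ => rfl⟩

theorem coord (hκ : ℵ₀ ≤ κ) (c : C) : DependsOnFew κ fun i : C → M => i c :=
  ⟨{c}, by simpa using one_le_aleph0.trans hκ, fun _ _ h => h c rfl⟩

/-- No condition on `g` is needed; this is what makes arbitrary choice functions and preimages
harmless. -/
theorem comp {f : (C → M) → β} (hf : DependsOnFew κ f) (g : β → γ) :
    DependsOnFew κ fun i => g (f i) := by
  obtain ⟨S, hS, hf⟩ := hf
  exact ⟨S, hS, fun i j h => congrArg g (hf h)⟩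

theorem pi {ι : Type z} (hκ : ℵ₀ ≤ κ) (hι : #ι ≤ κ) {f : ι → (C → M) → β}
    (hf : ∀ a, DependsOnFew κ (f a)) : DependsOnFew κ fun i a => f a i := by
  choose S hS hf using hf
  refine ⟨⋃ a, S a, (mk_iUnion_le S).trans ?_, fun i j h => funext fun a => hf a fun c hc =>
    h c (mem_iUnion.2 ⟨a, hc⟩)⟩
  exact (mul_le_mul' hι (ciSup_le' hS)).trans (mul_eq_self hκ).le

theorem pi_fin (hκ : ℵ₀ ≤ κ) {n : ℕ} {f : Fin n → (C → M) → β}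
    (hf : ∀ a, DependsOnFew κ (f a)) : DependsOnFew κ fun i a => f a i :=
  (pi (ι := ULift.{z} (Fin n)) hκ ((lt_aleph0_of_finite _).le.trans hκ)
    (f := fun a => f a.down) fun a => hf a.down).comp fun g a => g ⟨a⟩

theorem prodMk (hκ : ℵ₀ ≤ κ) {f : (C → M) → β} {g : (C → M) → γ} (hf : DependsOnFew κ f)
    (hg : DependsOnFew κ g) : DependsOnFew κ fun i => (f i, g i) := by
  obtain ⟨S, hS, hf⟩ := hf
  obtain ⟨T, hT, hg⟩ := hg
  refine ⟨S ∪ T, (mk_union_le S T).trans ((add_le_add hS hT).trans (add_eq_self hκ).le), ?_⟩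
  intro i j h
  exact Prod.ext (hf fun c hc => h c (Or.inl hc)) (hg fun c hc => h c (Or.inr hc))

/-- A function of few coordinates factors through a family of coordinates indexed by `K`. -/
theorem exists_eq [Nonempty M] [Nonempty C] {K : Type z} (hK : #K = κ) {f : (C → M) → β}
    (hf : DependsOnFew κ f) :
    ∃ (e : K → C) (r : (K → M) → C → M), ∀ i, f (r fun k => i (e k)) = f i := by
  classical
  inhabit M
  inhabit C
  obtain ⟨S, hS, hf⟩ := hf
  obtain ⟨g⟩ : Nonempty (S ↪ K) := by rwa [← Cardinal.le_def, hK]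
  -- The coordinates in `S` are listed along an injection into `K`; surplus indices repeat a default
  -- coordinate, so `e` need not be injective.
  let e : K → C := Function.extend g Subtype.val fun _ => default
  refine ⟨e, fun s => Function.extend e s fun _ => default, fun i => hf fun c hc => ?_⟩
  have he : e (g ⟨c, hc⟩) = c := g.injective.extend_apply _ _ _
  have hfac : Function.FactorsThrough (fun k => i (e k)) e := fun k l h => congrArg i h
  rw [← he]
  exact hfac.extend_apply _ _

end DependsOnFew

/-! ### The charge of a mean -/

section Charge

variable {C M : Type z} {κ : Cardinal.{z}}

/-- The algebra of the sets that depend on at most `κ` coordinates. -/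
def fewAlgebra (C M : Type z) (κ : Cardinal.{z}) : Set (Set (C → M)) :=
  {E | DependsOnFew κ fun i => i ∈ E}

theorem isSetAlgebra_fewAlgebra (hκ : ℵ₀ ≤ κ) : IsSetAlgebra (fewAlgebra C M κ) where
  empty_mem := DependsOnFew.const False
  compl_mem _ hs := hs.comp Not
  union_mem _ _ hs ht := (hs.prodMk hκ ht).comp fun p => p.1 ∨ p.2

theorem isComplete_fewAlgebra (hκ : ℵ₀ ≤ κ) :
    ChargeSpace.IsComplete (fewAlgebra C M κ) (Order.succ κ) := by
  intro S hS hc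
  have := (DependsOnFew.pi (ι := S) hκ (Order.lt_succ_iff.1 hc) (f := fun E i => i ∈ E.1)
    fun E => hS E.2).comp fun g => ∀ E, g E
  have heq : (fun i => i ∈ ⋂₀ S) = fun i => ∀ E : S, i ∈ E.1 := by
    funext i
    simp
  change DependsOnFew κ fun i => i ∈ ⋂₀ S
  rwa [heq]

open Classical in
/-- The charge space given by a mean on the sets that depend on few coordinates. -/
noncomputable def meanCharge (hκ : ℵ₀ ≤ κ) {F : ((C → M) → ℝ) →ₗ[ℝ] ℝ} (hF : IsMean F) :
    ChargeSpace (C → M) where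
  algebra := fewAlgebra C M κ
  isSetAlgebra := isSetAlgebra_fewAlgebra hκ
  charge := (isSetAlgebra_fewAlgebra hκ).isSetRing.addContent_of_union
    (fun E => (F (E.indicator fun _ => 1)).toNNReal) (by simp [← Pi.zero_def]) (by
      intro s t _ _ hst
      have hb : ∀ s : Set (C → M), 0 ≤ F (s.indicator fun _ => 1) := fun s =>
        hF.nonneg _ ⟨1, fun i => by by_cases h : i ∈ s <;> simp [h]⟩
          fun i => by by_cases h : i ∈ s <;> simp [h]
      rw [Set.indicator_union_of_disjoint hst, ← Real.toNNReal_add (hb s) (hb t), ← map_add]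
      rfl)
  charge_univ := by
    change (F (Set.univ.indicator fun _ => 1)).toNNReal = 1
    rw [Set.indicator_univ, hF.map_one, Real.toNNReal_one]

variable (hκ : ℵ₀ ≤ κ) {F : ((C → M) → ℝ) →ₗ[ℝ] ℝ} (hF : IsMean F)

theorem meanCharge_charge (E : Set (C → M)) :
    ((meanCharge hκ hF).charge E : ℝ) = F (E.indicator fun _ => 1) :=
  Real.coe_toNNReal _ (hF.nonneg _ ⟨1, fun i => by by_cases h : i ∈ E <;> simp [h]⟩
    fun i => by by_cases h : i ∈ E <;> simp [h])

theorem meanCharge_stepIntegral (l : List (ℝ × Set (C → M))) :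
    (meanCharge hκ hF).stepIntegral l = F (ChargeSpace.stepFun l) := by
  induction l with
  | nil => exact (hF.map_const 0).symm
  | cons p l ih =>
    have h : ChargeSpace.stepFun (p :: l) =
        p.1 • (p.2.indicator fun _ => (1 : ℝ)) + ChargeSpace.stepFun l := by
      funext i
      by_cases hi : i ∈ p.2 <;> simp [ChargeSpace.stepFun, hi]
    rw [h, map_add, map_smul, ← ih, ← meanCharge_charge hκ hF]
    simp [ChargeSpace.stepIntegral]

theorem stepFun_mem_boundedFunctions (l : List (ℝ × Set (C → M))) :
    ChargeSpace.stepFun l ∈ boundedFunctions (C → M) := by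
  induction l with
  | nil => exact const_mem_boundedFunctions 0
  | cons p l ih =>
    have h : ChargeSpace.stepFun (p :: l) =
        (p.2.indicator fun _ => p.1) + ChargeSpace.stepFun l := by
      funext i
      simp [ChargeSpace.stepFun]
    rw [h]
    exact Submodule.add_mem _
      ⟨|p.1|, fun i => by by_cases hi : i ∈ p.2 <;> simp [hi]⟩ ih

/-- The integral is an infimum over step functions above `f`, on which charge and mean agree;
measurability of `f` plays no role in this direction. -/
theorem le_meanCharge_integral {f : (C → M) → ℝ} (hf : f ∈ boundedFunctions (C → M)) :
    F f ≤ (meanCharge hκ hF).integral f := by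
  obtain ⟨D, hD⟩ := hf
  refine le_csInf ⟨D, ChargeSpace.const_mem_upperSums _ fun i => (abs_le.1 (hD i)).2⟩ ?_
  rintro _ ⟨l, -, hle, rfl⟩
  rw [meanCharge_stepIntegral]
  exact hF.mono ⟨D, hD⟩ (stepFun_mem_boundedFunctions l) hle

/-- The one-sided estimate is applied to `f` and `-f`; dependence on few coordinates makes `f`
measurable, so its upper and lower integrals coincide. -/
theorem meanCharge_integral {f : (C → M) → ℝ} (hf : f ∈ boundedFunctions (C → M))
    (hfew : DependsOnFew κ f) : (meanCharge hκ hF).integral f = F f := by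
  refine le_antisymm ?_ (le_meanCharge_integral hκ hF hf)
  have h := le_meanCharge_integral hκ hF (Submodule.neg_mem _ hf)
  obtain ⟨D, hD⟩ := hf
  have h' : (meanCharge hκ hF).integral (-f) = -(meanCharge hκ hF).integral f :=
    ChargeSpace.integral_neg _ (fun r s => hfew.comp fun x => x ∈ Ico r s) hD
  rw [map_neg, h'] at h
  linarith

/-! ### Small bases, meanability and measurable maps. -/

theorem exists_topologicalBasis_le {X : Type z} [MetricSpace X] (hκ : ℵ₀ ≤ κ)
    (hX : densityCharacter X ≤ κ) :
    ∃ O : Set (Set X), TopologicalSpace.IsTopologicalBasis O ∧ #O ≤ κ := by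
  obtain ⟨S, hS, hc⟩ : ∃ S : Set X, Dense S ∧ #S = densityCharacter X :=
    csInf_mem (s := {c | ∃ S : Set X, Dense S ∧ #S = c}) ⟨_, univ, dense_univ, rfl⟩
  refine ⟨range fun p : S × ℕ => Metric.ball p.1.1 (1 / ((p.2 : ℝ) + 1)), ?_, ?_⟩
  · refine TopologicalSpace.isTopologicalBasis_of_isOpen_of_nhds ?_ ?_
    · rintro _ ⟨p, rfl⟩
      exact Metric.isOpen_ball
    · intro a U ha hU
      obtain ⟨ε, hε, hball⟩ := Metric.isOpen_iff.1 hU a ha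
      obtain ⟨n, hn⟩ := exists_nat_one_div_lt (half_pos hε)
      obtain ⟨s, hs, hds⟩ := hS.exists_dist_lt a (Nat.one_div_pos_of_nat (α := ℝ) (n := n))
      refine ⟨_, ⟨(⟨s, hs⟩, n), rfl⟩, hds, fun y hy => hball ?_⟩
      rw [Metric.mem_ball] at hy ⊢
      have := dist_triangle y s a
      rw [dist_comm s a] at this
      linarith
  · have h1 : #(range fun p : S × ℕ => Metric.ball p.1.1 (1 / ((p.2 : ℝ) + 1))) ≤ #(S × ℕ) :=
      mk_range_le
    refine h1.trans ?_
    rw [mk_prod]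
    simp only [mk_nat, lift_aleph0, lift_uzero]
    exact (mul_le_mul' (hc.le.trans hX) hκ).trans (mul_eq_self hκ).le

theorem meanCharge_isMeanable {X : Type z} [MetricSpace X] (hX : densityCharacter X ≤ κ) :
    (meanCharge hκ hF).IsMeanable X := by
  refine ⟨Or.inr fun S hS hc => isComplete_fewAlgebra hκ S hS (hc.trans_le ?_)⟩
  obtain ⟨O, hO, hOκ⟩ := exists_topologicalBasis_le hκ hX
  refine Order.succ_le_succ ?_
  have hw : sInf {c | ∃ O : Set (Set X), TopologicalSpace.IsTopologicalBasis O ∧ #O = c} ≤ #O :=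
    csInf_le' ⟨O, hO, rfl⟩
  exact (add_le_add (hw.trans hOκ) hκ).trans (add_eq_self hκ).le

/-- A point is determined by the members of a basis that contain it. If `a` is measurable, each of
at most `κ` membership conditions depends on few coordinates, hence so does `a`. -/
theorem isMeasurableMap_meanCharge_iff {X : Type z} [MetricSpace X]
    (hX : densityCharacter X ≤ κ) {a : (C → M) → X} :
    (meanCharge hκ hF).IsMeasurableMap a ↔ DependsOnFew κ a := by
  refine ⟨fun h => ?_, fun h B _ => h.comp fun x => x ∈ B⟩
  obtain ⟨O, hO, hOκ⟩ := exists_topologicalBasis_le hκ hX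
  obtain ⟨S, hS, hd⟩ := DependsOnFew.pi (ι := O) hκ hOκ (f := fun U i => a i ∈ U.1) fun U =>
    h U.1 (MeasurableSpace.measurableSet_generateFrom (hO.isOpen U.2))
  refine ⟨S, hS, fun i j hij => ?_⟩
  have hU : ∀ U ∈ O, a i ∈ U ↔ a j ∈ U := fun U hU => iff_of_eq (congrFun (hd hij) ⟨U, hU⟩)
  exact hO.eq_iff.2 hU

end Charge

/-! ### Uniform bounds and Lipschitz constants of formulas -/

section Uniform

variable {L : LipschitzLanguage.{u, v, w}} {M : Type z} [PseudoMetricSpace M] [DiamLEOne M]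

theorem abs_iInf_sub_iInf_le {X : Type*} [Nonempty X] {f g : X → ℝ} {B C : ℝ}
    (hf : ∀ x, |f x| ≤ B) (hg : ∀ x, |g x| ≤ B) (h : ∀ x, |f x - g x| ≤ C) :
    |(⨅ x, f x) - ⨅ x, g x| ≤ C := by
  have hbf : BddBelow (range f) := ⟨-B, by rintro _ ⟨x, rfl⟩; exact (abs_le.1 (hf x)).1⟩
  have hbg : BddBelow (range g) := ⟨-B, by rintro _ ⟨x, rfl⟩; exact (abs_le.1 (hg x)).1⟩
  have h1 : (⨅ x, f x) - C ≤ ⨅ x, g x := le_ciInf fun x => by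
    linarith [ciInf_le hbf x, (abs_le.1 (h x)).2]
  have h2 : (⨅ x, g x) - C ≤ ⨅ x, f x := le_ciInf fun x => by
    linarith [ciInf_le hbg x, (abs_le.1 (h x)).1]
  exact abs_le.2 ⟨by linarith, by linarith⟩

/-- Valid without boundedness, by the conventions for real suprema and infima; the factor `-1`
matches the formula `smul (-1)`. -/
theorem iSup_eq_neg_iInf_neg {X : Type*} (f : X → ℝ) : ⨆ x, f x = -⨅ x, -1 * f x := by
  have h : range (fun x => -1 * f x) = -range f := by
    ext y
    simp only [mem_range, Set.mem_neg, neg_one_mul]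
    exact exists_congr fun x => neg_eq_iff_eq_neg
  rw [iInf, h, Real.sInf_neg, neg_neg, iSup]

/-- The quantifier `sup` is definable from `inf`. -/
theorem LipschitzLanguage.Formula.realize_sup [Prestructure L M] {n : ℕ} (φ : Formula L (n + 1))
    (a : Fin n → M) :
    (Formula.sup φ).realize a = (Formula.smul (-1) (.inf (.smul (-1) φ))).realize a := by
  simp only [Formula.realize]
  rw [iSup_eq_neg_iInf_neg]
  ring

variable (M) in
-- The bound is uniform over all prestructures on `M`, because the parameters will be reinterpreted
-- at every index. The same applies to the Lipschitz constants below.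
theorem LipschitzLanguage.Formula.exists_bound [Nonempty M] {n : ℕ} (φ : Formula L n) :
    ∃ B, ∀ [Prestructure L M] (a : Fin n → M), |φ.realize a| ≤ B := by
  induction φ with
  | one => exact ⟨1, by simp [Formula.realize]⟩
  | metric t₁ t₂ =>
    refine ⟨1, fun a => ?_⟩
    rw [Formula.realize, abs_of_nonneg dist_nonneg]
    exact DiamLEOne.dist_le_one _ _
  | rel R ts =>
    refine ⟨1, fun a => ?_⟩
    have := Prestructure.rel_mem R fun k => (ts k).realize a
    exact abs_le.2 ⟨neg_one_lt_zero.le.trans this.1, this.2⟩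
  | add φ ψ hφ hψ =>
    obtain ⟨B, hB⟩ := hφ
    obtain ⟨C, hC⟩ := hψ
    exact ⟨B + C, fun a => (abs_add_le _ _).trans (add_le_add (hB a) (hC a))⟩
  | smul r φ hφ =>
    obtain ⟨B, hB⟩ := hφ
    refine ⟨|r| * B, fun a => ?_⟩
    rw [Formula.realize, abs_mul]
    exact mul_le_mul_of_nonneg_left (hB a) (abs_nonneg r)
  | inf φ hφ =>
    obtain ⟨B, hB⟩ := hφ
    exact ⟨B, fun a => abs_iInf_le fun b => hB _⟩
  | sup φ hφ =>
    obtain ⟨B, hB⟩ := hφ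
    refine ⟨B, fun a => ?_⟩
    rw [Formula.realize_sup]
    simp only [Formula.realize, neg_one_mul, abs_neg]
    exact abs_iInf_le fun b => by simpa using hB _

variable (M) in
theorem LipschitzLanguage.Term.exists_lipschitz {n : ℕ} (t : Term L n) :
    ∃ C : ℝ, 0 ≤ C ∧ ∀ [Prestructure L M] (a b : Fin n → M),
      dist (t.realize a) (t.realize b) ≤ C * ∑ k, dist (a k) (b k) := by
  induction t with
  | var i =>
    refine ⟨1, zero_le_one, fun a b => ?_⟩
    rw [one_mul]
    exact Finset.single_le_sum (f := fun k => dist (a k) (b k)) (fun _ _ => dist_nonneg)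
      (Finset.mem_univ i)
  | const c => exact ⟨0, le_rfl, fun a b => by simp [Term.realize]⟩
  | app F ts ih =>
    choose C hC0 hC using ih
    refine ⟨L.funcLip F * ∑ k, C k,
      mul_nonneg (L.funcLip F).2 (Finset.sum_nonneg fun k _ => hC0 k), fun a b => ?_⟩
    refine (Prestructure.func_lip F _ _).trans ?_
    rw [mul_assoc, Finset.sum_mul]
    exact mul_le_mul_of_nonneg_left (Finset.sum_le_sum fun k _ => hC k a b) (L.funcLip F).2

theorem abs_rel_sub_le [Prestructure L M] (R : L.Rel) (a b : Fin (L.relArity R) → M) :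
    |Prestructure.rel R a - Prestructure.rel R b| ≤ L.relLip R * ∑ k, dist (a k) (b k) := by
  refine abs_sub_le_iff.2 ⟨Prestructure.rel_lip R a b, ?_⟩
  simpa only [dist_comm] using Prestructure.rel_lip R b a

variable (M) in
theorem LipschitzLanguage.Formula.exists_lipschitz [Nonempty M] {n : ℕ} (φ : Formula L n) :
    ∃ C : ℝ, ∀ [Prestructure L M] (a b : Fin n → M),
      |φ.realize a - φ.realize b| ≤ C * ∑ k, dist (a k) (b k) := by
  induction φ with
  | one => exact ⟨0, by simp [Formula.realize]⟩
  | metric t₁ t₂ =>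
    obtain ⟨C, -, hC⟩ := t₁.exists_lipschitz M
    obtain ⟨D, -, hD⟩ := t₂.exists_lipschitz M
    refine ⟨C + D, fun a b => (dist_dist_dist_le _ _ _ _).trans ?_⟩
    rw [add_mul]
    exact add_le_add (hC a b) (hD a b)
  | rel R ts =>
    choose C _ hC using fun k => (ts k).exists_lipschitz M
    refine ⟨L.relLip R * ∑ k, C k, fun a b => (abs_rel_sub_le R _ _).trans ?_⟩
    rw [mul_assoc, Finset.sum_mul]
    exact mul_le_mul_of_nonneg_left (Finset.sum_le_sum fun k _ => hC k a b) (L.relLip R).2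
  | add φ ψ hφ hψ =>
    obtain ⟨B, hB⟩ := hφ
    obtain ⟨C, hC⟩ := hψ
    refine ⟨B + C, fun a b => ?_⟩
    simp only [Formula.realize]
    rw [add_sub_add_comm, add_mul]
    exact (abs_add_le _ _).trans (add_le_add (hB a b) (hC a b))
  | smul r φ hφ =>
    obtain ⟨B, hB⟩ := hφ
    refine ⟨|r| * B, fun a b => ?_⟩
    simp only [Formula.realize]
    rw [← mul_sub, abs_mul, mul_assoc]
    exact mul_le_mul_of_nonneg_left (hB a b) (abs_nonneg r)
  | inf φ hφ =>
    obtain ⟨C, hC⟩ := hφ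
    obtain ⟨B, hB⟩ := φ.exists_bound M
    refine ⟨C, fun a b => abs_iInf_sub_iInf_le (B := B) (fun _ => hB _) (fun _ => hB _) fun c => ?_⟩
    -- Both tuples end in the same `c`, so the last distance vanishes and the constant does not
    -- grow.
    simpa [Fin.sum_univ_castSucc] using hC (Fin.snoc a c) (Fin.snoc b c)
  | sup φ hφ =>
    obtain ⟨C, hC⟩ := hφ
    obtain ⟨B, hB⟩ := φ.exists_bound M
    refine ⟨C, fun a b => ?_⟩
    rw [Formula.realize_sup, Formula.realize_sup]
    simp only [Formula.realize]
    rw [← mul_sub, abs_mul, abs_neg, abs_one, one_mul]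
    refine abs_iInf_sub_iInf_le (B := B) (fun _ => by simpa using hB _)
      (fun _ => by simpa using hB _) fun c => ?_
    rw [← mul_sub, abs_mul, abs_neg, abs_one, one_mul]
    simpa [Fin.sum_univ_castSucc] using hC (Fin.snoc a c) (Fin.snoc b c)

end Uniform

/-! ### Formulas with interpreted parameters -/

section Parameters

variable {L : LipschitzLanguage.{u, v, w}} {M : Type z} [PseudoMetricSpace M] [DiamLEOne M]
  [Prestructure L M] {A : Type z}

/-- The expansion of `M` in which the new constants are interpreted by `ρ`. -/
@[reducible]
def parameterExpansion (L : LipschitzLanguage.{u, v, w}) {M : Type z} [PseudoMetricSpace M]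
    [DiamLEOne M] [Prestructure L M] {A : Type z} (ρ : A → M) :
    Prestructure (L.withConstants A) M where
  const := Sum.elim (Prestructure.const (L := L)) ρ
  func := Prestructure.func (L := L)
  rel := Prestructure.rel (L := L)
  func_lip := Prestructure.func_lip (L := L)
  rel_mem := Prestructure.rel_mem (L := L)
  rel_lip := Prestructure.rel_lip (L := L)

/-- The value of a term with parameters interpreted by `ρ`. -/
def LipschitzLanguage.Term.realizeWith {n : ℕ} (ρ : A → M) (t : Term (L.withConstants A) n)
    (a : Fin n → M) : M :=
  letI := parameterExpansion L ρ
  t.realize a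

/-- The value of a formula with parameters interpreted by `ρ`. -/
noncomputable def LipschitzLanguage.Formula.realizeWith {n : ℕ} (ρ : A → M)
    (φ : Formula (L.withConstants A) n) (a : Fin n → M) : ℝ :=
  letI := parameterExpansion L ρ
  φ.realize a

variable (M) in
theorem LipschitzLanguage.Formula.exists_bound_realizeWith [Nonempty M] {n : ℕ}
    (φ : Formula (L.withConstants A) n) :
    ∃ B, ∀ (ρ : A → M) (a : Fin n → M), |φ.realizeWith ρ a| ≤ B := by
  obtain ⟨B, hB⟩ := φ.exists_bound M
  exact ⟨B, fun ρ a => @hB (parameterExpansion L ρ) a⟩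

variable (M) in
theorem LipschitzLanguage.Formula.exists_lipschitz_realizeWith [Nonempty M] {n : ℕ}
    (φ : Formula (L.withConstants A) n) :
    ∃ C : ℝ, ∀ (ρ : A → M) (a b : Fin n → M),
      |φ.realizeWith ρ a - φ.realizeWith ρ b| ≤ C * ∑ k, dist (a k) (b k) := by
  obtain ⟨C, hC⟩ := φ.exists_lipschitz M
  exact ⟨C, fun ρ a b => @hC (parameterExpansion L ρ) a b⟩

theorem LipschitzLanguage.Formula.realizeWith_sup {n : ℕ} (ρ : A → M)
    (φ : Formula (L.withConstants A) (n + 1)) (a : Fin n → M) :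
    (Formula.sup φ).realizeWith ρ a =
      (Formula.smul (-1) (.inf (.smul (-1) φ))).realizeWith ρ a :=
  @Formula.realize_sup _ _ _ _ (parameterExpansion L ρ) _ φ a

end Parameters

/-! ### The powermean theorem -/

/-- Used with `d` a multiple of a sum of distances of null mean: it makes the mean of a Lipschitz
expression independent of representatives. -/
theorem IsMean.eq_of_abs_sub_le {I : Type*} {F : (I → ℝ) →ₗ[ℝ] ℝ} (hF : IsMean F) {f g d : I → ℝ}
    (hf : f ∈ boundedFunctions I) (hg : g ∈ boundedFunctions I) (hd : d ∈ boundedFunctions I)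
    (h : ∀ i, |f i - g i| ≤ d i) (h0 : F d = 0) : F f = F g := by
  have h1 := hF.mono hf (Submodule.add_mem _ hg hd) fun i => by
    have := (abs_sub_le_iff.1 (h i)).1
    change f i ≤ g i + d i
    linarith
  have h2 := hF.mono hg (Submodule.add_mem _ hf hd) fun i => by
    have := (abs_sub_le_iff.1 (h i)).2
    change g i ≤ f i + d i
    linarith
  rw [map_add, h0, add_zero] at h1 h2
  exact le_antisymm h1 h2

theorem dist_mem_boundedFunctions {I : Type*} {M : Type*} [PseudoMetricSpace M] [DiamLEOne M]
    (a b : I → M) : (fun i => dist (a i) (b i)) ∈ boundedFunctions I :=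
  ⟨1, fun i => by simpa using DiamLEOne.dist_le_one _ _⟩

theorem IsMean.map_dist_congr {I : Type*} {M : Type*} [PseudoMetricSpace M] [DiamLEOne M]
    {F : (I → ℝ) →ₗ[ℝ] ℝ} (hF : IsMean F) {a a' b b' : I → M}
    (ha : F (fun i => dist (a i) (a' i)) = 0) (hb : F (fun i => dist (b i) (b' i)) = 0) :
    F (fun i => dist (a i) (b i)) = F fun i => dist (a' i) (b' i) :=
  hF.eq_of_abs_sub_le (dist_mem_boundedFunctions _ _) (dist_mem_boundedFunctions _ _)
    (Submodule.add_mem _ (dist_mem_boundedFunctions a a') (dist_mem_boundedFunctions b b'))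
    (fun _ => dist_dist_dist_le _ _ _ _) (by rw [map_add, ha, hb, add_zero])

theorem sum_dist_mem_boundedFunctions {I : Type*} {M : Type*} [PseudoMetricSpace M] [DiamLEOne M]
    {n : ℕ} (C : ℝ) (a b : Fin n → I → M) :
    (fun i => C * ∑ k, dist (a k i) (b k i)) ∈ boundedFunctions I := by
  have h : (fun i => C * ∑ k, dist (a k i) (b k i)) =
      C • ∑ k, fun i => dist (a k i) (b k i) := by
    funext i
    simp
  rw [h]
  exact Submodule.smul_mem _ _ (Submodule.sum_mem _ fun k _ => dist_mem_boundedFunctions _ _)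

theorem map_sum_dist_eq_zero {I : Type*} {M : Type*} [PseudoMetricSpace M]
    (F : (I → ℝ) →ₗ[ℝ] ℝ) {n : ℕ} (C : ℝ) (a b : Fin n → I → M)
    (h : ∀ k, F (fun i => dist (a k i) (b k i)) = 0) :
    F (fun i => C * ∑ k, dist (a k i) (b k i)) = 0 := by
  have h : (fun i => C * ∑ k, dist (a k i) (b k i)) =
      C • ∑ k, fun i => dist (a k i) (b k i) := by
    funext i
    simp
  rw [h, map_smul, map_sum]
  simp [*]

/-- A representative of an element of the powermean. -/
noncomputable def Powermean.out {I : Type z} {μ : ChargeSpace I} {M : Type z} [MetricSpace M]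
    [DiamLEOne M] (x : Powermean μ M) : MeasurableMap μ M :=
  Quotient.out x

/-- The map underlying the representative of an element of the powermean. -/
noncomputable def Powermean.rep {I : Type z} {μ : ChargeSpace I} {M : Type z} [MetricSpace M]
    [DiamLEOne M] (x : Powermean μ M) : I → M :=
  x.out.1

/-! ### The Łoś theorem for powermeans of mean charges. -/

section Los

open Powermean

variable {L : LipschitzLanguage.{u, v, w}} {C M : Type z} [MetricSpace M] [DiamLEOne M]
  [Prestructure L M] {κ : Cardinal.{z}} {hκ : ℵ₀ ≤ κ} {F : ((C → M) → ℝ) →ₗ[ℝ] ℝ}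
  {hF : IsMean F}

theorem Powermean.dependsOnFew_rep (hM : densityCharacter M ≤ κ)
    (x : Powermean (meanCharge hκ hF) M) : DependsOnFew κ (rep x) :=
  (isMeasurableMap_meanCharge_iff hκ hF hM).1 x.out.2

theorem MeasurableMap.dist_eq (hM : densityCharacter M ≤ κ)
    (x y : MeasurableMap (meanCharge hκ hF) M) :
    dist x y = F fun i => dist (x.1 i) (y.1 i) :=
  meanCharge_integral hκ hF (dist_mem_boundedFunctions _ _)
    ((((isMeasurableMap_meanCharge_iff hκ hF hM).1 x.2).prodMk hκ
      ((isMeasurableMap_meanCharge_iff hκ hF hM).1 y.2)).comp fun p => dist p.1 p.2)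

theorem Powermean.dist_eq (hM : densityCharacter M ≤ κ)
    (x y : Powermean (meanCharge hκ hF) M) :
    dist x y = F fun i => dist (rep x i) (rep y i) := by
  conv_lhs => rw [← Quotient.out_eq x, ← Quotient.out_eq y]
  exact (SeparationQuotient.dist_mk _ _).trans (MeasurableMap.dist_eq hM _ _)

theorem Powermean.map_dist_rep_mk (hM : densityCharacter M ≤ κ)
    (x : MeasurableMap (meanCharge hκ hF) M) :
    F (fun i => dist (rep (SeparationQuotient.mk x) i) (x.1 i)) = 0 :=
  (MeasurableMap.dist_eq hM _ _).symm.trans (SeparationQuotient.dist_out x)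

/-- Maps of few coordinates represent elements of the powermean. -/
theorem Powermean.exists_rep (hM : densityCharacter M ≤ κ) {a : (C → M) → M}
    (ha : DependsOnFew κ a) :
    ∃ x : Powermean (meanCharge hκ hF) M, F (fun i => dist (rep x i) (a i)) = 0 :=
  ⟨_, map_dist_rep_mk hM ⟨a, (isMeasurableMap_meanCharge_iff hκ hF hM).2 ha⟩⟩

variable {A : Set (Powermean (meanCharge hκ hF) M)}

/-- The interpretation of the parameters in `A` at the index `i`. -/
noncomputable def paramsAt (A : Set (Powermean (meanCharge hκ hF) M)) (i : C → M) (a : A) : M :=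
  rep a.1 i

theorem map_realizeWith_congr [Nonempty M] {n : ℕ} (φ : Formula (L.withConstants A) n)
    {a b : Fin n → (C → M) → M} (h : ∀ k, F (fun i => dist (a k i) (b k i)) = 0) :
    F (fun i => φ.realizeWith (paramsAt A i) fun k => a k i) =
      F fun i => φ.realizeWith (paramsAt A i) fun k => b k i := by
  obtain ⟨B, hB⟩ := φ.exists_bound_realizeWith M
  obtain ⟨c, hc⟩ := φ.exists_lipschitz_realizeWith M
  exact hF.eq_of_abs_sub_le ⟨B, fun i => hB _ _⟩ ⟨B, fun i => hB _ _⟩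
    (sum_dist_mem_boundedFunctions c a b) (fun i => hc _ _ _) (map_sum_dist_eq_zero F c a b h)

variable [hm : (meanCharge hκ hF).IsMeanable M]

/-- Only null distance can be expected: the quotient picks a fresh representative after each
operation. The induction replaces it by the pointwise operation (`h1`) and then moves inside by the
Lipschitz condition (`h2`). -/
theorem LipschitzLanguage.Term.map_dist_realize (hM : densityCharacter M ≤ κ) {n : ℕ}
    (t : Term (L.withConstants A) n) (a : Fin n → Powermean (meanCharge hκ hF) M) :
    F (fun i => dist (rep (t.realize a) i)
      (t.realizeWith (paramsAt A i) fun k => rep (a k) i)) = 0 := by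
  induction t with
  | var k =>
    simpa [Term.realize, Term.realizeWith] using hF.map_const 0
  | const c =>
    rcases c with c | c
    · exact map_dist_rep_mk hM (Prestructure.const (L := L) c)
    · have h : ∀ i, (Term.const (.inr c) : Term (L.withConstants A) n).realizeWith (paramsAt A i)
          (fun k => rep (a k) i) =
          rep ((Term.const (.inr c) : Term (L.withConstants A) n).realize a) i := fun i => rfl
      simpa only [h, dist_self] using hF.map_const 0
  | app G ts ih =>
    have h1 := map_dist_rep_mk hM (Prestructure.func (L := L) G
      fun k => Powermean.out ((ts k).realize a))
    have h2 := map_sum_dist_eq_zero F (L.funcLip G) (fun k i => rep ((ts k).realize a) i)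
      (fun k i => (ts k).realizeWith (paramsAt A i) fun k => rep (a k) i) ih
    refine (hF.eq_of_abs_sub_le (g := fun i => dist
        (rep ((Term.app G ts : Term (L.withConstants A) n).realize a) i)
        (Prestructure.func (L := L) G fun k => rep ((ts k).realize a) i))
      (dist_mem_boundedFunctions _ _) (dist_mem_boundedFunctions _ _)
      (sum_dist_mem_boundedFunctions _ _ _) (fun i => ?_) h2).trans h1
    rw [← Real.dist_eq]
    refine (dist_dist_dist_le_right _ _ _).trans ?_
    rw [dist_comm]
    exact Prestructure.func_lip (L := L) G _ _

variable [Nonempty M]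

/-- Every element of the powermean gives at least the mean of the pointwise infima; conversely,
pointwise ε-optimal witnesses form an element of the powermean. -/
theorem realize_inf_eq_map (hM : densityCharacter M ≤ κ) (hA : #A ≤ κ) {n : ℕ}
    (φ : Formula (L.withConstants A) (n + 1))
    (hφ : ∀ a : Fin (n + 1) → Powermean (meanCharge hκ hF) M,
      φ.realize a = F fun i => φ.realizeWith (paramsAt A i) fun k => rep (a k) i)
    (a : Fin n → Powermean (meanCharge hκ hF) M) :
    (Formula.inf φ).realize a =
      F fun i => (Formula.inf φ).realizeWith (paramsAt A i) fun k => rep (a k) i := by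
  obtain ⟨B, hB⟩ := φ.exists_bound_realizeWith M
  have hsnoc : ∀ (x : Powermean (meanCharge hκ hF) M) (i : C → M),
      (fun k => rep ((Fin.snoc a x : Fin (n + 1) → Powermean (meanCharge hκ hF) M) k) i) =
        Fin.snoc (fun k => rep (a k) i) (rep x i) := by
    intro x i
    funext k
    refine Fin.lastCases ?_ (fun k => ?_) k <;> simp
  have hinf : ∀ i, (Formula.inf φ).realizeWith (paramsAt A i) (fun k => rep (a k) i) =
      ⨅ m : M, φ.realizeWith (paramsAt A i)
        (Fin.snoc (fun k => rep (a k) i) m : Fin (n + 1) → M) := fun i => rfl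
  have hbdd : ∀ i, BddBelow (range fun m : M => φ.realizeWith (paramsAt A i)
      (Fin.snoc (fun k => rep (a k) i) m : Fin (n + 1) → M)) := fun i =>
    ⟨-B, by rintro _ ⟨m, rfl⟩; exact (abs_le.1 (hB _ _)).1⟩
  have hbi : (fun i => (Formula.inf φ).realizeWith (paramsAt A i) fun k => rep (a k) i) ∈
      boundedFunctions (C → M) := ⟨B, fun i => by
    simp only [hinf]
    exact abs_iInf_le fun m => hB _ _⟩
  have hlow : ∀ x, F (fun i => (Formula.inf φ).realizeWith (paramsAt A i) fun k => rep (a k) i) ≤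
      φ.realize (Fin.snoc a x : Fin (n + 1) → Powermean (meanCharge hκ hF) M) := by
    intro x
    rw [hφ]
    refine hF.mono hbi ⟨B, fun i => hB _ _⟩ fun i => ?_
    rw [hinf, hsnoc]
    exact ciInf_le (hbdd i) (rep x i)
  have hne : Nonempty (Powermean (meanCharge hκ hF) M) :=
    ⟨(exists_rep hM (DependsOnFew.const (Classical.arbitrary M))).choose⟩
  refine le_antisymm (le_of_forall_pos_le_add fun ε hε => ?_) (le_ciInf hlow)
  have hsel : ∀ p : (A → M) × (Fin n → M), ∃ m : M,
      φ.realizeWith p.1 (Fin.snoc p.2 m : Fin (n + 1) → M) <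
        (⨅ m : M, φ.realizeWith p.1 (Fin.snoc p.2 m : Fin (n + 1) → M)) + ε := fun p =>
    exists_lt_of_ciInf_lt (lt_add_of_pos_right _ hε)
  -- The witness is chosen as a function of the parameters and the tuple, not of the index `i`;
  -- hence it depends on few coordinates.
  choose s hs using hsel
  have hfew : DependsOnFew κ fun i : C → M => s (paramsAt A i, fun k => rep (a k) i) :=
    ((DependsOnFew.pi (f := fun (a : A) i => rep a.1 i) hκ hA
      fun a => dependsOnFew_rep hM a.1).prodMk hκ
        (DependsOnFew.pi_fin hκ fun k => dependsOnFew_rep hM (a k))).comp s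
  obtain ⟨x, hx⟩ := exists_rep (hκ := hκ) (hF := hF) hM hfew
  refine (ciInf_le ⟨_, by rintro _ ⟨y, rfl⟩; exact hlow y⟩ x).trans ?_
  rw [hφ, map_realizeWith_congr (hF := hF) φ (b := fun k i => (Fin.snoc (fun k => rep (a k) i)
    (s (paramsAt A i, fun k => rep (a k) i)) : Fin (n + 1) → M) k)]
  · have h := hF.mono (f := fun i => φ.realizeWith (paramsAt A i)
        (Fin.snoc (fun k => rep (a k) i) (s (paramsAt A i, fun k => rep (a k) i)) :
          Fin (n + 1) → M)) ⟨B, fun i => hB _ _⟩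
      (Submodule.add_mem _ hbi (const_mem_boundedFunctions ε)) fun i => (hs _).le
    rwa [map_add, hF.map_const] at h
  · refine Fin.lastCases ?_ fun k => ?_
    · simpa using hx
    · simpa using hF.map_const 0

/-- Affine formulas commute with the mean. -/
theorem LipschitzLanguage.Formula.realize_eq_map (hM : densityCharacter M ≤ κ) (hA : #A ≤ κ)
    {n : ℕ} (φ : Formula (L.withConstants A) n)
    (a : Fin n → Powermean (meanCharge hκ hF) M) :
    φ.realize a = F fun i => φ.realizeWith (paramsAt A i) fun k => rep (a k) i := by
  have hsmul : ∀ {n : ℕ} (r : ℝ) (φ : Formula (L.withConstants A) n)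
      (a : Fin n → Powermean (meanCharge hκ hF) M),
      φ.realize a = F (fun i => φ.realizeWith (paramsAt A i) fun k => rep (a k) i) →
      (Formula.smul r φ).realize a =
        F fun i => (Formula.smul r φ).realizeWith (paramsAt A i) fun k => rep (a k) i := by
    intro n r φ a h
    rw [Formula.realize, h, ← smul_eq_mul, ← map_smul]
    rfl
  induction φ with
  | one => exact hF.map_one.symm
  | metric t₁ t₂ =>
    refine (Powermean.dist_eq hM _ _).trans ?_
    exact hF.map_dist_congr (t₁.map_dist_realize (hF := hF) hM a)
      (t₂.map_dist_realize (hF := hF) hM a)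
  | rel R ts =>
    have hb : ∀ x : (C → M) → Fin (L.relArity R) → M,
        (fun i => Prestructure.rel (L := L) R (x i)) ∈ boundedFunctions (C → M) := fun x =>
      ⟨1, fun i => abs_le.2
        ⟨neg_one_lt_zero.le.trans (Prestructure.rel_mem (L := L) R (x i)).1,
          (Prestructure.rel_mem (L := L) R (x i)).2⟩⟩
    have h1 : (Formula.rel R ts : Formula (L.withConstants A) _).realize a =
        F fun i => Prestructure.rel (L := L) R fun k => rep ((ts k).realize a) i :=
      meanCharge_integral hκ hF (hb _) ((DependsOnFew.pi_fin hκ fun k =>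
        dependsOnFew_rep hM ((ts k).realize a)).comp (Prestructure.rel (L := L) R))
    rw [h1]
    exact hF.eq_of_abs_sub_le (hb _) (hb _) (sum_dist_mem_boundedFunctions _ _ _)
      (fun i => abs_rel_sub_le (L := L) R _ _)
      (map_sum_dist_eq_zero F (L.relLip R) (fun k i => rep ((ts k).realize a) i)
        (fun k i => (ts k).realizeWith (paramsAt A i) fun k => rep (a k) i)
        fun k => (ts k).map_dist_realize hM a)
  | add φ ψ hφ hψ =>
    rw [Formula.realize, hφ, hψ, ← map_add]
    rfl
  | smul r φ hφ => exact hsmul r φ a (hφ a)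
  | inf φ hφ => exact realize_inf_eq_map hM hA φ hφ a
  | sup φ hφ =>
    rw [Formula.realize_sup]
    simp only [Formula.realizeWith_sup]
    exact hsmul _ _ _ (realize_inf_eq_map hM hA _ (fun a => hsmul _ _ _ (hφ a)) a)

end Los

/-! ### Saturation -/

-- A type over `A` is turned into an extension problem in the coordinates carrying `A`. The mean
-- solves that problem, so its own coordinate function realizes the type.
open Powermean in
theorem isSaturated_powermean_meanCharge {L : LipschitzLanguage.{u, v, w}} {K M : Type z}
    [MetricSpace M] [Nonempty M] [DiamLEOne M] [Prestructure L M] {κ : Cardinal.{z}}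
    (hκ : ℵ₀ ≤ κ) (hM : densityCharacter M ≤ κ) (hK : #K = κ)
    {F : (Point K M → ℝ) →ₗ[ℝ] ℝ} (hF : IsMean F)
    (hsol : ∀ e q, Consistent F e q → Solved F e q) [(meanCharge hκ hF).IsMeanable M] :
    IsSaturated L (Powermean (meanCharge hκ hF) M) (Order.succ κ) := by
  intro A hA p
  replace hA : #A ≤ κ := Order.lt_succ_iff.1 hA
  have : Nonempty (Coord K (ExtensionProblem K M)) := ⟨.base⟩
  obtain ⟨e, r, hr⟩ := DependsOnFew.exists_eq hK
    (DependsOnFew.pi (f := fun (a : A) i => rep a.1 i) hκ hA fun a => dependsOnFew_rep hM a.1)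
  replace hr : ∀ i, paramsAt A (r fun k => i (e k)) = paramsAt A i := hr
  -- The map `r` rebuilds from `s` enough of an index to recover all parameters, so formulas become
  -- functions of `(s, x)`.
  let val : Formula (L.withConstants A) 1 → (K → M) → M → ℝ := fun φ s x =>
    φ.realizeWith (paramsAt A (r s)) fun _ => x
  let q : ExtensionProblem K M :=
    { carrier := range fun φ : Formula (L.withConstants A) 1 => (val φ, p.toLinearMap φ.toSpace)
      add_mem' := by
        rintro _ _ ⟨φ, rfl⟩ ⟨ψ, rfl⟩
        exact ⟨.add φ ψ, Prod.ext rfl (p.toLinearMap.map_add φ.toSpace ψ.toSpace)⟩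
      zero_mem' := by
        refine ⟨.smul 0 .one, Prod.ext ?_ ?_⟩
        · funext s x
          exact zero_mul _
        · exact (p.toLinearMap.map_smul 0 Formula.one.toSpace).trans (zero_mul _)
      smul_mem' := by
        rintro t _ ⟨φ, rfl⟩
        exact ⟨.smul t φ, Prod.ext rfl (p.toLinearMap.map_smul t φ.toSpace)⟩ }
  have hcons : Consistent F e q := by
    rintro _ ⟨φ, rfl⟩
    obtain ⟨B, hB⟩ := φ.exists_bound_realizeWith M
    refine ⟨⟨B, fun s x => hB _ _⟩, ?_⟩
    let a₀ : Fin 0 → Powermean (meanCharge hκ hF) M := Fin.elim0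
    have hinf : (Formula.inf φ).realize a₀ =
        F fun i => ⨅ x, val φ (fun k => i (e k)) x := by
      rw [Formula.realize_eq_map hM hA]
      congr 1
      funext i
      change (⨅ x, φ.realizeWith (paramsAt A i) _) = ⨅ x, φ.realizeWith _ _
      rw [hr]
      refine iInf_congr fun x => congrArg _ (funext fun k => ?_)
      obtain rfl : k = Fin.last 0 := Subsingleton.elim (α := Fin 1) _ _
      rw [Fin.snoc_last]
    change (F fun i => ⨅ x, val φ (fun k => i (e k)) x) ≤ p.toLinearMap φ.toSpace
    rw [← hinf]
    set t := (Formula.inf φ).realize a₀ with ht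
    -- With `t` the infimum of `φ` in the powermean, `φ - t` is nonnegative there, so positivity of
    -- `p` gives `t ≤ p(φ)`; by the Łoś theorem this is consistency.
    have hpos := p.nonneg (φ.toSpace + (-t) • Formula.one.toSpace) (by
      intro a
      change 0 ≤ φ.realize a + (-t) * 1
      have hlow : BddBelow (range fun x => φ.realize (Fin.snoc a₀ x : Fin 1 → _)) := by
        have : Nonempty (Powermean (meanCharge hκ hF) M) := ⟨a 0⟩
        obtain ⟨B, hB⟩ := φ.exists_bound (Powermean (meanCharge hκ hF) M)
        exact ⟨-B, by rintro _ ⟨x, rfl⟩; exact (abs_le.1 (hB _)).1⟩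
      have h1 : t ≤ φ.realize (Fin.snoc a₀ (a 0) : Fin 1 → _) := ciInf_le hlow (a 0)
      have h2 : (Fin.snoc a₀ (a 0) : Fin 1 → Powermean (meanCharge hκ hF) M) = a := by
        funext k
        obtain rfl : k = Fin.last 0 := Subsingleton.elim (α := Fin 1) _ _
        rw [Fin.snoc_last]
        rfl
      rw [h2] at h1
      linarith)
    rw [map_add, map_smul, p.map_one] at hpos
    simp only [smul_eq_mul, mul_one] at hpos
    linarith
  obtain ⟨x, hx⟩ := exists_rep (hκ := hκ) (hF := hF) hM
    (DependsOnFew.coord hκ (Coord.mk e q))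
  refine ⟨fun _ => x, fun φ => ?_⟩
  rw [Formula.realize_eq_map hM hA, map_realizeWith_congr (hF := hF) φ (a := fun _ => rep x)
    (b := fun _ i => i (.mk e q)) fun _ => hx]
  have h := hsol e q hcons (val φ, p.toLinearMap φ.toSpace) ⟨φ, rfl⟩
  simp only [val, hr] at h
  exact h.symm

theorem mainTheorem7 (L : LipschitzLanguage.{u, v, w}) {M : Type z} [MetricSpace M]
    [CompleteSpace M] [Nonempty M] [DiamLEOne M] [Prestructure L M] (κ : Cardinal.{z})
    (hκ : ℵ₀ ≤ κ) (hM : densityCharacter M ≤ κ) :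
    ∃ (I : Type z) (μ : ChargeSpace I) (_ : μ.IsMeanable M),
      IsSaturated L (Powermean μ M) (Order.succ κ) := by
  obtain ⟨F, hF, hsol⟩ := exists_isMean_solved κ.out M
  have := meanCharge_isMeanable (X := M) hκ hF hM
  exact ⟨_, meanCharge hκ hF, this,
    isSaturated_powermean_meanCharge hκ hM (mk_out κ) hF hsol⟩
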